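/- Let $k$ be a field of characteristic $0$ and $\mathcal H$ a simply connected graded commutative $k$-algebra of finite type ($\mathcal H^0=k$, $\mathcal H^1=0$, each $\mathcal H^n$ finite dimensional). Let $(R,d)\to\mathcal H$ be a weighted model, representing the formal rational homotopy space $X_{\mathcal H}$: $R$ is a free graded commutative algebra on generators that are homogeneous for total degree $n>0$ and weight $w\ge n$, $d$ is a differential that raises the total degree by $1$ and preserves the weight, and $R\to\mathcal H$ is a quasi-isomorphism that preserves the total degree and vanishes on components with $n\neq w$. A *weighted algebra* is a commutative $k$-algebra $B=\bigoplus_{n\ge 0}B_n$, graded by weight, with $B_0=k$; put $m_B=\bigoplus_{n>0}B_n$. Morphisms preserve the weight. A *weighted deformation* of $X_{\mathcal H}$ over $\operatorname{Spec} B$ is the family $\operatorname{Spec}(R\otimes B,\,d+e)\to\operatorname{Spec}B$ given by a derivation $e:R\to R\otimes m_B$ of total degree $1$ that preserves the total weight (hence lowers the weight in $R$), with $(d+e)^2=0$. An isomorphism of deformations over $B$ is a weight-preserving isomorphism of differential graded $B$-algebras that is the identity modulo $m_B$; $M(B)$ denotes the set of isomorphism classes. Families over $\operatorname{Spec}A$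 and $\operatorname{Spec}B$ are isomorphic if an isomorphism of weighted algebras $A\cong B$ carries the first to a deformation over $B$ isomorphic to the second. A weighted deformation over $V=\operatorname{Spec}A$ is *versal* if the induced map of functors $V=\operatorname{Hom}(A,-)\to M$ on weighted algebras is smooth: for every surjection $B\to B'$ with $m_{B'}^2=0$ the map $V(B)\to V(B')\times_{M(B')}M(B)$ is surjective. It is *miniversal* if, moreover, the map of tangent spaces $TV\to TM$ is an isomorphism, i.e. $V(k[\varepsilon]/\varepsilon^2)\to M(k[\varepsilon]/\varepsilon^2)$ is bijective for $\varepsilon$ of each weight $i>0$. **Theorem.** 1. Let $X\to\operatorname{Spec}A$ be a versal weighted deformation of $X_{\mathcal H}$. Assume that $R$ is of finite type (finite dimensional in each pair of total degree and weight) or that $A$ is of finite type (finite dimensional in each weight, e.g. finitely generated). Then there are a miniversal weighted deformation $Y\to\operatorname{Spec}B$ and a weighted polynomial algebra $C$ (on any set of generators, each of positive weight) such that $X\to\operatorname{Spec}A$ is isomorphic to the product of $Y\to\operatorname{Spec}B$ and the trivial family $X_{\mathcal H}\times\operatorname{Spec}C\to\operatorname{Spec}C$, that is, to the family $Y\times\operatorname{Spec}C\to\operatorname{Spec}B\times\operatorname{Spec}C=\operatorname{Spec}(B\otimes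 C)$ with total space $\operatorname{Spec}(R\otimes B\otimes C,\,d+e_Y)$, where $e_Y$ is the derivation of the family $Y$. 2. Without any finiteness assumption on $A$ or $R$: if $X\to\operatorname{Spec}A$ is a versal weighted deformation of $X_{\mathcal H}$, then for every miniversal weighted deformation $Y\to\operatorname{Spec}B$ of $X_{\mathcal H}$ there is a weighted polynomial algebra $C$ for which such an isomorphism exists. 3. In particular, any two miniversal weighted deformations of $X_{\mathcal H}$ are isomorphic (no canonical isomorphism is asserted). -/

import Mathlib

open scoped TensorProduct

universe u v w

namespace WeightedDeformation

noncomputable section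

/-! ### Weighted augmented algebras -/

/-- A weighted (conical) augmented `k`-algebra: a commutative `k`-algebra with a grading
`B = ⨁ Bₙ`, `n ≥ 0`, such that `B₀ = k`. The augmentation is the projection to `B₀ = k`. -/
structure WeightedAlgebra (k : Type u) [Field k] where
  carrier : Type u
  [commRing : CommRing carrier]
  [algebra : Algebra k carrier]
  [nontrivial : Nontrivial carrier]
  part : ℕ → Submodule k carrier
  [gradedMonoid : SetLike.GradedMonoid part]
  internal : DirectSum.IsInternal part
  connected : part 0 = 1

attribute [instance] WeightedAlgebra.commRing WeightedAlgebra.algebra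
  WeightedAlgebra.nontrivial WeightedAlgebra.gradedMonoid

instance (k : Type u) [Field k] : CoeSort (WeightedAlgebra k) (Type u) :=
  ⟨WeightedAlgebra.carrier⟩

variable {k : Type u} [Field k]

namespace WeightedAlgebra

/-- Each weight component is finite dimensional. -/
def IsFiniteType (B : WeightedAlgebra k) : Prop :=
  ∀ n, Module.Finite k (B.part n)

/-- The augmentation ideal, as a subspace: the sum of the components of positive weight. -/
def aug (B : WeightedAlgebra k) : Submodule k B :=
  ⨆ n : ℕ, B.part (n + 1)

end WeightedAlgebra

/-- Morphisms of weighted augmented algebras: algebra homomorphisms that preserve the weight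
(they are then compatible with the augmentations). -/
structure WHom (A B : WeightedAlgebra k) where
  toAlgHom : A →ₐ[k] B
  map_mem : ∀ n, ∀ a ∈ A.part n, toAlgHom a ∈ B.part n

namespace WHom

variable {A B C : WeightedAlgebra k}

instance : CoeFun (WHom A B) (fun _ => A → B) := ⟨fun f => f.toAlgHom⟩

def comp (g : WHom B C) (f : WHom A B) : WHom A C where
  toAlgHom := g.toAlgHom.comp f.toAlgHom
  map_mem n a ha := g.map_mem n _ (f.map_mem n a ha)

end WHom

/-- A family of subspaces that spans and is separated by projections is a direct sum. -/
theorem isInternal_of_proj {V : Type*} [AddCommGroup V] [Module k V] (P : ℕ → Submodule k V)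
    (π : ℕ → V →ₗ[k] V) (h₁ : ∀ n, ∀ x ∈ P n, π n x = x)
    (h₂ : ∀ m n, m ≠ n → ∀ x ∈ P m, π n x = 0) (h₃ : ⨆ n, P n = ⊤) :
    DirectSum.IsInternal P := by
  rw [DirectSum.isInternal_submodule_iff_iSupIndep_and_iSup_eq_top]
  refine ⟨fun n => ?_, h₃⟩
  rw [Submodule.disjoint_def]
  intro x hx hx'
  have hle : (⨆ (j) (_ : j ≠ n), P j) ≤ LinearMap.ker (π n) :=
    iSup₂_le fun j hj y hy => h₂ j n hj y hy
  rw [← h₁ n x hx]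
  exact hle hx'

/-- The projection to a component of a direct sum. -/
theorem exists_proj {V : Type*} [AddCommGroup V] [Module k V] (P : ℕ → Submodule k V)
    (hP : DirectSum.IsInternal P) :
    ∃ π : ℕ → V →ₗ[k] V, (∀ n, ∀ x ∈ P n, π n x = x) ∧
      (∀ m n, m ≠ n → ∀ x ∈ P m, π n x = 0) := by
  classical
  let _ := hP.chooseDecomposition
  refine ⟨fun n => (P n).subtype ∘ₗ DirectSum.component k ℕ (fun i => P i) n ∘ₗ
    (DirectSum.decomposeLinearEquiv P).toLinearMap, ?_, ?_⟩
  · intro n x hx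
    exact DirectSum.decompose_of_mem_same P hx
  · intro m n hmn x hx
    exact DirectSum.decompose_of_mem_ne P hx hmn

/-! ### The dual numbers, polynomial algebras and tensor products -/

/-- The dual numbers `k[ε]/ε²` with `ε` of weight `i > 0`. -/
def dual (k : Type u) [Field k] (i : ℕ) (hi : 0 < i) : WeightedAlgebra k where
  carrier := DualNumber k
  part n :=
    { carrier := {x | (n ≠ 0 → TrivSqZeroExt.fst x = 0) ∧ (n ≠ i → TrivSqZeroExt.snd x = 0)}
      add_mem' := by
        rintro x y ⟨h₁, h₂⟩ ⟨h₃, h₄⟩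
        exact ⟨fun h => by simp [h₁ h, h₃ h], fun h => by simp [h₂ h, h₄ h]⟩
      zero_mem' := by simp
      smul_mem' := by
        rintro c x ⟨h₁, h₂⟩
        exact ⟨fun h => by simp [h₁ h], fun h => by simp [h₂ h]⟩ }
  gradedMonoid :=
    { one_mem := by
        refine ⟨fun h => absurd rfl h, fun _ => by simp⟩
      mul_mem := by
        rintro m n x y ⟨h₁, h₂⟩ ⟨h₃, h₄⟩
        refine ⟨fun h => ?_, fun h => ?_⟩
        · rcases Nat.eq_zero_or_pos m with hm | hm
          · have : n ≠ 0 := by omega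
            simp [h₃ this]
          · simp [h₁ hm.ne']
        · simp only [TrivSqZeroExt.snd_mul, smul_eq_mul, MulOpposite.smul_eq_mul_unop,
            MulOpposite.unop_op]
          have e₁ : TrivSqZeroExt.fst x * TrivSqZeroExt.snd y = 0 := by
            by_cases hm : m = 0
            · have : n ≠ i := by omega
              simp [h₄ this]
            · simp [h₁ hm]
          have e₂ : TrivSqZeroExt.snd x * TrivSqZeroExt.fst y = 0 := by
            by_cases hn : n = 0
            · have : m ≠ i := by omega
              simp [h₂ this]
            · simp [h₃ hn]
          rw [e₁, e₂, add_zero] }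
  internal := by
    refine isInternal_of_proj _ (fun n =>
      (if n = 0 then (TrivSqZeroExt.inlAlgHom k k k).toLinearMap ∘ₗ
          (TrivSqZeroExt.fstHom k k k).toLinearMap else 0) +
      (if n = i then TrivSqZeroExt.inrHom k k ∘ₗ TrivSqZeroExt.sndHom k k else 0)) ?_ ?_ ?_
    · rintro n x ⟨h₁, h₂⟩
      by_cases hn : n = 0
      · have : n ≠ i := by omega
        have hs := h₂ this
        ext <;> simp [hn, hs, hi.ne]
      · by_cases hn' : n = i
        · have hf := h₁ hn
          ext <;> simp [hn', hf, hi.ne']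
        · have hf := h₁ hn
          have hs := h₂ hn'
          ext <;> simp [hn, hn', hf, hs]
    · rintro m n hmn x ⟨h₁, h₂⟩
      by_cases hn : n = 0
      · have hf := h₁ (by omega)
        have : n ≠ i := by omega
        ext <;> simp [hn, hf, hi.ne]
      · by_cases hn' : n = i
        · have hs := h₂ (by omega)
          ext <;> simp [hn', hs, hi.ne']
        · simp [hn, hn']
    · rw [eq_top_iff]
      intro x _
      rw [← TrivSqZeroExt.inl_fst_add_inr_snd_eq x]
      refine Submodule.add_mem _ (Submodule.mem_iSup_of_mem 0 ?_)
        (Submodule.mem_iSup_of_mem i ?_)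
      · exact ⟨fun h => absurd rfl h, fun _ => by simp⟩
      · exact ⟨fun _ => by simp, fun h => absurd rfl h⟩
  connected := by
    ext x
    rw [Submodule.mem_one]
    constructor
    · rintro ⟨-, h⟩
      refine ⟨TrivSqZeroExt.fst x, ?_⟩
      have hs := h hi.ne
      ext <;> simp [TrivSqZeroExt.algebraMap_eq_inl, hs]
    · rintro ⟨c, rfl⟩
      exact ⟨fun h => absurd rfl h, fun _ => by simp [TrivSqZeroExt.algebraMap_eq_inl]⟩

/-- The weighted polynomial algebra `k[x_s : s ∈ σ]` with `x_s` of weight `c s > 0`. -/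
def poly (k : Type u) [Field k] {σ : Type u} (c : σ → ℕ) (hc : ∀ s, 0 < c s) :
    WeightedAlgebra k where
  carrier := MvPolynomial σ k
  part n := MvPolynomial.weightedHomogeneousSubmodule k c n
  gradedMonoid := MvPolynomial.WeightedHomogeneousSubmodule.gradedMonoid
  internal := by
    classical
    let _ := MvPolynomial.weightedGradedAlgebra k c
    exact DirectSum.Decomposition.isInternal _
  connected := by
    classical
    ext p
    rw [Submodule.mem_one, MvPolynomial.mem_weightedHomogeneousSubmodule]
    constructor
    · intro hp
      refine ⟨MvPolynomial.coeff 0 p, ?_⟩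
      ext d
      rw [MvPolynomial.algebraMap_eq, MvPolynomial.coeff_C]
      split_ifs with h
      · rw [h]
      · by_contra hne
        have h0 := hp (Ne.symm hne)
        apply h
        ext s
        rw [Finsupp.weight_apply, Finsupp.sum, Finset.sum_eq_zero_iff] at h0
        by_contra hs
        have hs' : d s ≠ 0 := fun h => hs (by simp [h])
        have := h0 s (by simpa using hs')
        simp only [smul_eq_mul, mul_eq_zero] at this
        rcases this with h | h
        · exact hs' h
        · exact (hc s).ne' h
    · rintro ⟨a, rfl⟩
      exact MvPolynomial.isWeightedHomogeneous_C c a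

/-- The component of weight `n` of `B ⊗ C`. -/
def tensorPart (B C : WeightedAlgebra k) (n : ℕ) : Submodule k (B ⊗[k] C) :=
  Submodule.span k {x | ∃ i j, i + j = n ∧ ∃ b ∈ B.part i, ∃ c ∈ C.part j, x = b ⊗ₜ[k] c}

/-- The tensor product of weighted algebras, the coordinate ring of `Spec B × Spec C`. -/
def tensor (B C : WeightedAlgebra k) : WeightedAlgebra k where
  carrier := B ⊗[k] C
  nontrivial := by infer_instance
  part := tensorPart B C
  gradedMonoid :=
    { one_mem := Submodule.subset_span
        ⟨0, 0, rfl, 1, SetLike.GradedOne.one_mem, 1, SetLike.GradedOne.one_mem, rfl⟩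
      mul_mem := by
        intro m n x y hx hy
        induction hx using Submodule.span_induction with
        | zero => simp
        | add x₁ x₂ _ _ h₁ h₂ => rw [add_mul]; exact Submodule.add_mem _ h₁ h₂
        | smul a x₁ _ h₁ => rw [smul_mul_assoc]; exact Submodule.smul_mem _ a h₁
        | mem x hx =>
          obtain ⟨i, j, hij, b, hb, c, hc, rfl⟩ := hx
          induction hy using Submodule.span_induction with
          | zero => simp
          | add x₁ x₂ _ _ h₁ h₂ => rw [mul_add]; exact Submodule.add_mem _ h₁ h₂
          | smul a x₁ _ h₁ => rw [mul_smul_comm]; exact Submodule.smul_mem _ a h₁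
          | mem y hy =>
            obtain ⟨i', j', hij', b', hb', c', hc', rfl⟩ := hy
            rw [Algebra.TensorProduct.tmul_mul_tmul]
            exact Submodule.subset_span ⟨i + i', j + j', by omega, _,
              SetLike.GradedMul.mul_mem hb hb', _, SetLike.GradedMul.mul_mem hc hc', rfl⟩ }
  internal := by
    obtain ⟨p, hp₁, hp₂⟩ := exists_proj B.part B.internal
    obtain ⟨q, hq₁, hq₂⟩ := exists_proj C.part C.internal
    have key : ∀ n i j, ∀ b ∈ B.part i, ∀ c ∈ C.part j,
        (∑ ij ∈ Finset.HasAntidiagonal.antidiagonal n, TensorProduct.map (p ij.1) (q ij.2)) (b ⊗ₜ[k] c) =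
          if i + j = n then b ⊗ₜ[k] c else 0 := by
      intro n i j b hb c hc
      rw [LinearMap.sum_apply]
      split_ifs with h
      · rw [Finset.sum_eq_single_of_mem (i, j) (by simpa using h)]
        · simp [hp₁ i b hb, hq₁ j c hc]
        · rintro ⟨i', j'⟩ _ hne
          by_cases hi : i = i'
          · have hj : j ≠ j' := fun hj => hne (by rw [hi, hj])
            simp [hq₂ j j' hj c hc]
          · simp [hp₂ i i' hi b hb]
      · refine Finset.sum_eq_zero ?_
        rintro ⟨i', j'⟩ hij
        rw [Finset.HasAntidiagonal.mem_antidiagonal] at hij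
        by_cases hi : i = i'
        · have hj : j ≠ j' := by
            rintro rfl
            exact h (by rw [hi]; exact hij)
          simp [hq₂ j j' hj c hc]
        · simp [hp₂ i i' hi b hb]
    refine isInternal_of_proj _
      (fun n => ∑ ij ∈ Finset.HasAntidiagonal.antidiagonal n, TensorProduct.map (p ij.1) (q ij.2)) ?_ ?_ ?_
    · intro n x hx
      induction hx using Submodule.span_induction with
      | zero => simp
      | add x₁ x₂ _ _ h₁ h₂ => rw [map_add, h₁, h₂]
      | smul a x₁ _ h₁ => rw [map_smul, h₁]
      | mem x hx =>
        obtain ⟨i, j, hij, b, hb, c, hc, rfl⟩ := hx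
        rw [key n i j b hb c hc, if_pos hij]
    · intro m n hmn x hx
      induction hx using Submodule.span_induction with
      | zero => simp
      | add x₁ x₂ _ _ h₁ h₂ => rw [map_add, h₁, h₂, add_zero]
      | smul a x₁ _ h₁ => rw [map_smul, h₁, smul_zero]
      | mem x hx =>
        obtain ⟨i, j, hij, b, hb, c, hc, rfl⟩ := hx
        rw [key n i j b hb c hc, if_neg (by omega)]
    · rw [eq_top_iff]
      rintro x -
      induction x using TensorProduct.induction_on with
      | zero => simp
      | add x y hx hy => exact Submodule.add_mem _ hx hy
      | tmul b c =>
        have hb : b ∈ ⨆ n, B.part n := by rw [B.internal.submodule_iSup_eq_top]; trivial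
        have hc : c ∈ ⨆ n, C.part n := by rw [C.internal.submodule_iSup_eq_top]; trivial
        induction hb using Submodule.iSup_induction' with
        | zero => simp
        | add b₁ b₂ _ _ h₁ h₂ => rw [TensorProduct.add_tmul]; exact Submodule.add_mem _ h₁ h₂
        | mem i b hb =>
          induction hc using Submodule.iSup_induction' with
          | zero => simp
          | add c₁ c₂ _ _ h₁ h₂ =>
            rw [TensorProduct.tmul_add]; exact Submodule.add_mem _ h₁ h₂
          | mem j c hc =>
            exact Submodule.mem_iSup_of_mem (i + j)
              (Submodule.subset_span ⟨i, j, rfl, b, hb, c, hc, rfl⟩)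
  connected := by
    apply le_antisymm
    · refine Submodule.span_le.2 ?_
      rintro x ⟨i, j, hij, b, hb, c, hc, rfl⟩
      obtain ⟨rfl, rfl⟩ : i = 0 ∧ j = 0 := by omega
      rw [B.connected, Submodule.mem_one] at hb
      rw [C.connected, Submodule.mem_one] at hc
      obtain ⟨s, rfl⟩ := hb
      obtain ⟨t, rfl⟩ := hc
      refine Submodule.mem_one.2 ⟨s * t, ?_⟩
      rw [Algebra.TensorProduct.algebraMap_apply, Algebra.algebraMap_eq_smul_one (A := C) t,
        TensorProduct.tmul_smul, TensorProduct.smul_tmul', Algebra.smul_def, map_mul, mul_comm]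
    · rw [Submodule.one_le]
      exact Submodule.subset_span
        ⟨0, 0, rfl, 1, SetLike.GradedOne.one_mem, 1, SetLike.GradedOne.one_mem, rfl⟩

/-- The inclusion `B → B ⊗ C`, i.e. the projection `Spec B × Spec C → Spec B`. -/
def tensorInl (B C : WeightedAlgebra k) : WHom B (tensor B C) where
  toAlgHom := (Algebra.TensorProduct.includeLeft : B →ₐ[k] B ⊗[k] C)
  map_mem n b hb := by
    change b ⊗ₜ[k] (1 : C) ∈ tensorPart B C n
    exact Submodule.subset_span ⟨n, 0, rfl, b, hb, 1, SetLike.GradedOne.one_mem, rfl⟩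

/-! ### Cohomology algebras and their weighted models -/

/-- A simply connected graded commutative algebra of finite type. -/
structure SimplyConnectedCGA (k : Type u) [Field k] where
  carrier : Type w
  [ring : Ring carrier]
  [algebra : Algebra k carrier]
  [nontrivial : Nontrivial carrier]
  part : ℕ → Submodule k carrier
  [gradedMonoid : SetLike.GradedMonoid part]
  internal : DirectSum.IsInternal part
  comm : ∀ m n, ∀ a ∈ part m, ∀ b ∈ part n, a * b = (-1 : k) ^ (m * n) • (b * a)
  part_zero : part 0 = 1
  part_one : part 1 = ⊥
  finite : ∀ n, Module.Finite k (part n)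

attribute [instance] SimplyConnectedCGA.ring SimplyConnectedCGA.algebra
  SimplyConnectedCGA.nontrivial SimplyConnectedCGA.gradedMonoid

instance (k : Type u) [Field k] : CoeSort (SimplyConnectedCGA.{u, w} k) (Type w) :=
  ⟨SimplyConnectedCGA.carrier⟩

/-- A weighted differential graded commutative algebra: `part (n, w)` is the component of total
degree `n` and weight `w`; the differential raises the total degree by one and preserves
the weight; commutativity is with respect to the total degree. -/
structure WeightedDGCA (k : Type u) [Field k] where
  carrier : Type v
  [ring : Ring carrier]
  [algebra : Algebra k carrier]
  part : ℕ × ℕ → Submodule k carrier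
  [gradedMonoid : SetLike.GradedMonoid part]
  internal : DirectSum.IsInternal part
  comm : ∀ p q, ∀ a ∈ part p, ∀ b ∈ part q, a * b = (-1 : k) ^ (p.1 * q.1) • (b * a)
  d : carrier →ₗ[k] carrier
  d_mem : ∀ n w, ∀ a ∈ part (n, w), d a ∈ part (n + 1, w)
  d_mul : ∀ n w, ∀ a ∈ part (n, w), ∀ b, d (a * b) = d a * b + (-1 : k) ^ n • (a * d b)
  d_d : ∀ a, d (d a) = 0

attribute [instance] WeightedDGCA.ring WeightedDGCA.algebra WeightedDGCA.gradedMonoid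

instance (k : Type u) [Field k] : CoeSort (WeightedDGCA.{u, v} k) (Type v) :=
  ⟨WeightedDGCA.carrier⟩

/-- Each component of given total degree and weight is finite dimensional. -/
def WeightedDGCA.IsFiniteType (R : WeightedDGCA.{u, v} k) : Prop :=
  ∀ p, Module.Finite k (R.part p)

/-- A weighted model `ρ : (R, d) → (H, 0)`: the algebra `R` is the free graded commutative algebra
on bihomogeneous generators `gen s`, of positive total degree and of resolution degree
(total degree minus weight) at most zero, and `ρ` is a quasi-isomorphism that vanishes in nonzero
resolution degree. Such a pair represents the formal space `X_H`. -/
structure WeightedModel (R : WeightedDGCA.{u, v} k) (H : SimplyConnectedCGA.{u, w} k) where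
  index : Type v
  gen : index → R
  deg : index → ℕ
  wt : index → ℕ
  gen_mem : ∀ s, gen s ∈ R.part (deg s, wt s)
  deg_pos : ∀ s, 0 < deg s
  deg_le_wt : ∀ s, deg s ≤ wt s
  /-- The generators generate `R`. -/
  gen_surjective : Function.Surjective (FreeAlgebra.lift k gen)
  /-- All relations between them follow from graded commutativity. -/
  gen_relations : TwoSidedIdeal.ker (FreeAlgebra.lift k gen) =
    TwoSidedIdeal.span {x | ∃ s t, x = FreeAlgebra.ι k s * FreeAlgebra.ι k t -
      (-1 : k) ^ (deg s * deg t) • (FreeAlgebra.ι k t * FreeAlgebra.ι k s)}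
  ρ : R →ₐ[k] H
  ρ_mem : ∀ n w, ∀ a ∈ R.part (n, w), ρ a ∈ H.part n
  ρ_eq_zero : ∀ n w, n ≠ w → ∀ a ∈ R.part (n, w), ρ a = 0
  ρ_d : ∀ a, ρ (R.d a) = 0
  ρ_cohomology_surjective : ∀ h : H, ∃ a, R.d a = 0 ∧ ρ a = h
  ρ_cohomology_injective : ∀ a, R.d a = 0 → ρ a = 0 → ∃ b, R.d b = a

/-! ### Deformations over a weighted base -/

/-- The part of `B ⊗ R` of total degree `n` and total weight `w` that lies in `m_B ⊗ R`. Since the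
weights of `m_B` are positive, the weights of the factors from `R` are smaller than `w`. -/
def lowPart (R : WeightedDGCA.{u, v} k) (B : WeightedAlgebra k) (n w : ℕ) :
    Submodule k (B ⊗[k] R) :=
  Submodule.span k {x | ∃ i j, 0 < i ∧ i + j = w ∧
    ∃ b ∈ B.part i, ∃ r ∈ R.part (n, j), x = b ⊗ₜ[k] r}

/-- For `e : R → B ⊗ R`, the `B`-linear endomorphism `d + e` of `B ⊗ R`. -/
def totalD (R : WeightedDGCA.{u, v} k) (B : WeightedAlgebra k) (e : R →ₗ[k] B ⊗[k] R) :
    B ⊗[k] R →ₗ[B] B ⊗[k] R :=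
  R.d.baseChange B + e.liftBaseChange B

/-- A weighted deformation, parametrized by `Spec B`, of the space with model `R`:
a derivation `e` of degree one from `R` to `m_B ⊗ R` that preserves the total weight
(hence lowers the weight filtration of `R`), with `(d + e)² = 0`. The family is
`Spec (B ⊗ R, d + e) → Spec B`. -/
structure Deformation (R : WeightedDGCA.{u, v} k) (B : WeightedAlgebra k) where
  e : R →ₗ[k] B ⊗[k] R
  leibniz : ∀ n w, ∀ a ∈ R.part (n, w), ∀ b,
    e (a * b) = e a * (1 ⊗ₜ[k] b) + (-1 : k) ^ n • ((1 ⊗ₜ[k] a) * e b)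
  mem_lowPart : ∀ n w, ∀ a ∈ R.part (n, w), e a ∈ lowPart R B (n + 1) w
  sq_zero : totalD R B e ∘ₗ totalD R B e = 0

namespace Deformation

variable {R : WeightedDGCA.{u, v} k} {A B C : WeightedAlgebra k}

/-- The differential `d + e` of the total space. -/
def D (E : Deformation R B) : B ⊗[k] R →ₗ[B] B ⊗[k] R := totalD R B E.e

/-- The map `R ⊗ A → R ⊗ B` induced by `f : A → B`. -/
def baseMap (R : WeightedDGCA.{u, v} k) (f : WHom A B) : A ⊗[k] R →ₐ[k] B ⊗[k] R :=
  Algebra.TensorProduct.map f.toAlgHom (AlgHom.id k R)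

@[simp] theorem baseMap_tmul (f : WHom A B) (a : A) (r : R) :
    baseMap R f (a ⊗ₜ r) = f a ⊗ₜ r := by
  simp [baseMap]

theorem baseMap_smul (f : WHom A B) (a : A) (x : A ⊗[k] R) :
    baseMap R f (a • x) = f a • baseMap R f x := by
  induction x using TensorProduct.induction_on with
  | zero => simp
  | add x y hx hy => simp only [smul_add, map_add, hx, hy]
  | tmul b r => simp [TensorProduct.smul_tmul']

theorem baseMap_lowPart (f : WHom A B) (n w : ℕ) (x : A ⊗[k] R) (hx : x ∈ lowPart R A n w) :
    baseMap R f x ∈ lowPart R B n w := by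
  induction hx using Submodule.span_induction with
  | zero => simp
  | add x₁ x₂ _ _ h₁ h₂ => rw [map_add]; exact Submodule.add_mem _ h₁ h₂
  | smul a x₁ _ h₁ => rw [map_smul]; exact Submodule.smul_mem _ a h₁
  | mem x hx =>
    obtain ⟨i, j, hi, hij, b, hb, r, hr, rfl⟩ := hx
    rw [baseMap_tmul]
    exact Submodule.subset_span ⟨i, j, hi, hij, _, f.map_mem i b hb, r, hr, rfl⟩

theorem totalD_baseMap (f : WHom A B) (e : R →ₗ[k] A ⊗[k] R) (x : A ⊗[k] R) :
    totalD R B ((baseMap R f).toLinearMap ∘ₗ e) (baseMap R f x) =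
      baseMap R f (totalD R A e x) := by
  induction x using TensorProduct.induction_on with
  | zero => simp
  | add x y hx hy => simp only [map_add, hx, hy]
  | tmul b r => simp [totalD, baseMap_smul]

/-- The pullback of a family along `Spec B → Spec A`. -/
def map (E : Deformation R A) (f : WHom A B) : Deformation R B where
  e := (baseMap R f).toLinearMap ∘ₗ E.e
  leibniz n w a ha b := by
    simp [E.leibniz n w a ha b]
  mem_lowPart n w a ha := baseMap_lowPart f _ _ _ (E.mem_lowPart n w a ha)
  sq_zero := by
    ext r
    have h₁ : (1 : B) ⊗ₜ[k] r = baseMap R f ((1 : A) ⊗ₜ[k] r) := by simp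
    have h₂ := LinearMap.congr_fun E.sq_zero ((1 : A) ⊗ₜ[k] r)
    simp only [LinearMap.comp_apply, LinearMap.zero_apply] at h₂
    simp only [TensorProduct.AlgebraTensorModule.curry_apply, LinearMap.restrictScalars_comp,
      TensorProduct.curry_apply, LinearMap.comp_apply, LinearMap.coe_restrictScalars]
    rw [h₁, totalD_baseMap, totalD_baseMap, h₂, map_zero]
    simp

/-- Isomorphism of deformations over the same base: an isomorphism of weighted differential graded
`B`-algebras `(B ⊗ R, d + e) ≃ (B ⊗ R, d + e')` that induces the identity of the special fibre,
i.e. is the identity modulo `m_B`. -/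
def IsIso (E E' : Deformation R B) : Prop :=
  ∃ φ : B ⊗[k] R ≃ₐ[B] B ⊗[k] R,
    (∀ n w, ∀ a ∈ R.part (n, w), φ (1 ⊗ₜ[k] a) - 1 ⊗ₜ[k] a ∈ lowPart R B n w) ∧
    ∀ x, φ (E.D x) = E'.D (φ x)

theorem smul_lowPart {i j n : ℕ} {b : B} (hb : b ∈ B.part i) {x : B ⊗[k] R}
    (hx : x ∈ lowPart R B n j) : b • x ∈ lowPart R B n (i + j) := by
  induction hx using Submodule.span_induction with
  | zero => simp
  | add x₁ x₂ _ _ h₁ h₂ => rw [smul_add]; exact Submodule.add_mem _ h₁ h₂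
  | smul a x₁ _ h₁ => rw [smul_comm]; exact Submodule.smul_mem _ a h₁
  | mem x hx =>
    obtain ⟨i', j', hi', hij', b', hb', r, hr, rfl⟩ := hx
    exact Submodule.subset_span ⟨i + i', j', by omega, by omega, _,
      SetLike.GradedMul.mul_mem hb hb', r, hr, by simp [TensorProduct.smul_tmul']⟩

/-- If a `B`-algebra map is the identity modulo `m_B` in weights below `w`, it preserves the
parts `lowPart R B n w`. -/
theorem map_lowPart (φ : B ⊗[k] R →ₐ[B] B ⊗[k] R) (n w : ℕ)
    (hφ : ∀ j < w, ∀ a ∈ R.part (n, j), φ (1 ⊗ₜ[k] a) - 1 ⊗ₜ[k] a ∈ lowPart R B n j)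
    (x : B ⊗[k] R) (hx : x ∈ lowPart R B n w) : φ x ∈ lowPart R B n w := by
  induction hx using Submodule.span_induction with
  | zero => simp
  | add x₁ x₂ _ _ h₁ h₂ => rw [map_add]; exact Submodule.add_mem _ h₁ h₂
  | smul a x₁ _ h₁ =>
    have h := map_smul (φ.restrictScalars k) a x₁
    rw [AlgHom.restrictScalars_apply, AlgHom.restrictScalars_apply] at h
    rw [h]
    exact Submodule.smul_mem _ a h₁
  | mem x hx =>
    obtain ⟨i, j, hi, hij, b, hb, r, hr, rfl⟩ := hx
    have h₁ : b ⊗ₜ[k] r = b • ((1 : B) ⊗ₜ[k] r) := by simp [TensorProduct.smul_tmul']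
    have h₂ : φ (b ⊗ₜ[k] r) = b • (φ (1 ⊗ₜ[k] r) - 1 ⊗ₜ[k] r) + b ⊗ₜ[k] r := by
      rw [h₁, map_smul, smul_sub, sub_add_cancel]
    rw [h₂]
    refine Submodule.add_mem _ ?_ (Submodule.subset_span ⟨i, j, hi, hij, b, hb, r, hr, rfl⟩)
    have h₃ := smul_lowPart hb (hφ j (by omega) r hr)
    rwa [hij] at h₃

theorem IsIso.refl (E : Deformation R B) : IsIso E E :=
  ⟨AlgEquiv.refl, fun n w a _ => by simp, fun x => by simp⟩

theorem IsIso.symm {E E' : Deformation R B} (h : IsIso E E') : IsIso E' E := by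
  obtain ⟨φ, h₁, h₂⟩ := h
  refine ⟨φ.symm, ?_, fun x => ?_⟩
  · intro n w
    induction w using Nat.strong_induction_on with
    | _ w ih =>
      intro a ha
      have h₃ : φ.symm (1 ⊗ₜ[k] a) - 1 ⊗ₜ[k] a =
          - φ.symm (φ (1 ⊗ₜ[k] a) - 1 ⊗ₜ[k] a) := by
        rw [map_sub, AlgEquiv.symm_apply_apply]; abel
      rw [h₃]
      exact Submodule.neg_mem _
        (map_lowPart φ.symm.toAlgHom n w (fun j hj a ha => ih j hj a ha) _ (h₁ n w a ha))
  · rw [AlgEquiv.symm_apply_eq, h₂, AlgEquiv.apply_symm_apply]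

theorem IsIso.trans {E E' E'' : Deformation R B} (h : IsIso E E') (h' : IsIso E' E'') :
    IsIso E E'' := by
  obtain ⟨φ, h₁, h₂⟩ := h
  obtain ⟨ψ, h₃, h₄⟩ := h'
  refine ⟨φ.trans ψ, fun n w a ha => ?_, fun x => ?_⟩
  · have h₅ : (φ.trans ψ) (1 ⊗ₜ[k] a) - 1 ⊗ₜ[k] a =
        ψ (φ (1 ⊗ₜ[k] a) - 1 ⊗ₜ[k] a) + (ψ (1 ⊗ₜ[k] a) - 1 ⊗ₜ[k] a) := by
      rw [map_sub, AlgEquiv.trans_apply]; abel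
    rw [h₅]
    exact Submodule.add_mem _
      (map_lowPart ψ.toAlgHom n w (fun j _ a ha => h₃ n j a ha) _ (h₁ n w a ha)) (h₃ n w a ha)
  · rw [AlgEquiv.trans_apply, AlgEquiv.trans_apply, h₂, h₄]

instance setoid (R : WeightedDGCA.{u, v} k) (B : WeightedAlgebra k) : Setoid (Deformation R B) where
  r := IsIso
  iseqv := ⟨IsIso.refl, IsIso.symm, IsIso.trans⟩

end Deformation

/-- The moduli functor: `Moduli R B` is the set `M(B)` of deformations parametrized by `Spec B`,
modulo isomorphism. -/
def Moduli (R : WeightedDGCA.{u, v} k) (B : WeightedAlgebra k) : Type (max u v) :=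
  Quotient (Deformation.setoid R B)

namespace Deformation

variable {R : WeightedDGCA.{u, v} k} {A B C : WeightedAlgebra k}

/-- Pullback along `Spec B → Spec A` respects isomorphism. -/
theorem IsIso.map {E E' : Deformation R A} (h : IsIso E E') (f : WHom A B) :
    IsIso (E.map f) (E'.map f) := by
  obtain ⟨φ, h₁, h₂⟩ := h
  let ext' (ψ : A ⊗[k] R →ₐ[A] A ⊗[k] R) : B ⊗[k] R →ₐ[B] B ⊗[k] R :=
    Algebra.TensorProduct.lift (Algebra.ofId B (B ⊗[k] R))
      ((baseMap R f).comp ((ψ.restrictScalars k).comp Algebra.TensorProduct.includeRight))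
      (fun b r => Algebra.commutes b _)
  have hext₁ : ∀ (ψ : A ⊗[k] R →ₐ[A] A ⊗[k] R) (r : R),
      ext' ψ (1 ⊗ₜ[k] r) = baseMap R f (ψ (1 ⊗ₜ[k] r)) := by
    intro ψ r
    refine (Algebra.TensorProduct.lift_tmul _ _ _ _ _).trans ?_
    rw [map_one, one_mul]
    simp
  have hext : ∀ (ψ : A ⊗[k] R →ₐ[A] A ⊗[k] R) (x : A ⊗[k] R),
      ext' ψ (baseMap R f x) = baseMap R f (ψ x) := by
    intro ψ x
    induction x using TensorProduct.induction_on with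
    | zero => simp
    | add x y hx hy => simp only [map_add, hx, hy]
    | tmul a r =>
      have e₁ : a ⊗ₜ[k] r = a • ((1 : A) ⊗ₜ[k] r) := by simp [TensorProduct.smul_tmul']
      have e₂ : baseMap R f ((1 : A) ⊗ₜ[k] r) = 1 ⊗ₜ[k] r := by simp
      rw [e₁, baseMap_smul, map_smul, map_smul, baseMap_smul, e₂, hext₁]
  have hinv : ∀ ψ χ : A ⊗[k] R →ₐ[A] A ⊗[k] R, (∀ x, ψ (χ x) = x) →
      (ext' ψ).comp (ext' χ) = AlgHom.id B _ := by
    intro ψ χ hψ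
    ext r
    simp [hext₁, hext, hψ]
  refine ⟨AlgEquiv.ofAlgHom (ext' φ.toAlgHom) (ext' φ.symm.toAlgHom)
    (hinv _ _ (fun x => by simp)) (hinv _ _ (fun x => by simp)), ?_, ?_⟩
  · intro n w a ha
    have e₂ : baseMap R f ((1 : A) ⊗ₜ[k] a) = 1 ⊗ₜ[k] a := by simp
    change ext' φ.toAlgHom (1 ⊗ₜ[k] a) - 1 ⊗ₜ[k] a ∈ _
    rw [hext₁, ← e₂, ← map_sub]
    exact baseMap_lowPart f n w _ (h₁ n w a ha)
  · intro x
    change ext' φ.toAlgHom ((E.map f).D x) = (E'.map f).D (ext' φ.toAlgHom x)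
    induction x using TensorProduct.induction_on with
    | zero => simp
    | add x y hx hy => simp only [map_add, hx, hy]
    | tmul b r =>
      have e₁ : b ⊗ₜ[k] r = b • baseMap R f ((1 : A) ⊗ₜ[k] r) := by
        simp [TensorProduct.smul_tmul']
      have e₃ : ∀ (E : Deformation R A) x, (E.map f).D (baseMap R f x) = baseMap R f (E.D x) :=
        fun E x => totalD_baseMap f E.e x
      rw [e₁]
      simp only [map_smul, hext, e₃]
      exact congrArg (fun z => b • baseMap R f z) (h₂ _)

end Deformation

/-- The map `M(A) → M(B)` induced by `f : A → B`. -/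
def Moduli.map {R : WeightedDGCA.{u, v} k} {A B : WeightedAlgebra k} (f : WHom A B) :
    Moduli R A → Moduli R B :=
  Quotient.map (fun E => E.map f) (fun _ _ h => Deformation.IsIso.map h f)

namespace Deformation

variable {R : WeightedDGCA.{u, v} k} {A B C : WeightedAlgebra k}

/-- The map of functors `V → M`, `V = Spec A`, induced by a deformation over `V`; here
`V(B) = Hom(A, B)`. -/
def classify (E : Deformation R A) (B : WeightedAlgebra k) (f : WHom A B) : Moduli R B :=
  Quotient.mk (setoid R B) (E.map f)

/-- A weighted deformation over `V = Spec A` is versal if the map of functors `V → M` is smooth: for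
each surjection `B → B'` with `(m_{B'})² = 0`, the map `V(B) → V(B') ×_{M(B')} M(B)` is
surjective. -/
def IsVersal (E : Deformation R A) : Prop :=
  ∀ (B B' : WeightedAlgebra k) (p : WHom B B'), Function.Surjective p →
    (∀ x ∈ B'.aug, ∀ y ∈ B'.aug, x * y = 0) →
    ∀ (f' : WHom A B') (m : Moduli R B), E.classify B' f' = Moduli.map p m →
      ∃ f : WHom A B, p.comp f = f' ∧ E.classify B f = m

/-- A weighted deformation over `V = Spec A` is miniversal if it is versal and the Kodaira-Spencer map
`TV → TM` is an isomorphism. The tangent spaces are graded, with component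
`V(k[ε]) → M(k[ε])`, `ε² = 0`, `ε` of weight `i`, for each `i > 0`. -/
def IsMiniversal (E : Deformation R A) : Prop :=
  E.IsVersal ∧ ∀ (i : ℕ) (hi : 0 < i), Function.Bijective (E.classify (dual k i hi))

/-- The product of a family over `Spec B` with the trivial family with base `Spec C`: the family over
`Spec B × Spec C` with total space `Spec (B ⊗ R, d + e) × Spec C`. -/
def prodTrivial (E : Deformation R B) (C : WeightedAlgebra k) : Deformation R (tensor B C) :=
  E.map (tensorInl B C)

/-- Isomorphism of families with possibly different bases: an isomorphism of the bases along
which the families correspond, up to isomorphism. -/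
def FamilyIso (E : Deformation R A) (F : Deformation R B) : Prop :=
  ∃ f : WHom A B, Function.Bijective f ∧ IsIso (E.map f) F

end Deformation

end

end WeightedDeformation

/-!
Over a base `Z` whose augmentation ideal has square zero, two families are isomorphic precisely when
their difference is the coboundary of a derivation `R → m_Z ⊗ R`. For the base changes of a family
`E` over `A` along `f, g : A → Z` this is a linear condition on `f - g`, namely the solvability of a
system of linear equations whose unknown is the derivation. If `R` or `A` is of finite type, then
eliminating the unknown by duality turns it into the vanishing of `f - g` on a fixed graded
subspace `T` of `A` that contains `1` and `m²`: the kernel of the Kodaira-Spencer map of `E`.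

A morphism that induces an isomorphism on `m / m²` is an isomorphism. So if `F` over `B` is
miniversal and `E` over `A` is versal, then morphisms `f : A → B` and `g : B → A` that carry `E` and
`F` to each other make `g` injective on `m / m²`. With coordinates `x` on the cokernel, the first
order morphism `f + x` lifts by versality to an isomorphism `A → B ⊗ k[x]` that carries `E` to the
product of `F` with the trivial family.

For the existence of `F`, let `x` be coordinates on `A / T` and `l` homogeneous lifts of them to
`A`. The first order morphism `id + x : A → A ⊗ k[x]` carries `E` to the trivial extension of `E`,
because `x` vanishes on `T`; by versality it lifts to a morphism `φ` that does the same. The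
`A`-algebra endomorphism of `A ⊗ k[x]` with `x ↦ φ l - l` is the identity to first order, hence
invertible. Composing `φ` with its inverse and then with `x ↦ -l` yields an endomorphism of `A` that
preserves the class of `E` and kills every `l`. It factors through `A / (l)`, and the restriction of
`E` to `Spec A / (l)` is miniversal.
-/

namespace WeightedDeformation

noncomputable section

variable {k : Type u} [Field k]

/-! ### Weighted algebras -/

namespace WeightedAlgebra

section

variable (A : WeightedAlgebra k)

instance gradedAlgebra : GradedAlgebra A.part :=
  { A.gradedMonoid, A.internal.chooseDecomposition with }

/-- The projection to the component of weight `n`, as an endomorphism. -/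
def proj (n : ℕ) : A →ₗ[k] A := GradedAlgebra.proj A.part n

/-- The augmentation ideal `m_A`, as an ideal. -/
def maxIdeal : Ideal A := (HomogeneousIdeal.irrelevant A.part).toIdeal

end

variable {A B Z : WeightedAlgebra k}

theorem proj_mem (n : ℕ) (a : A) : A.proj n a ∈ A.part n := by
  rw [proj, GradedAlgebra.proj_apply]
  exact SetLike.coe_mem _

theorem proj_of_mem {n : ℕ} {a : A} (ha : a ∈ A.part n) : A.proj n a = a :=
  DirectSum.decompose_of_mem_same _ ha

theorem proj_of_mem_of_ne {m n : ℕ} {a : A} (ha : a ∈ A.part m) (hmn : m ≠ n) :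
    A.proj n a = 0 :=
  DirectSum.decompose_of_mem_ne _ ha hmn

theorem eq_of_forall_proj_eq {a b : A} (h : ∀ n, A.proj n a = A.proj n b) : a = b :=
  (DirectSum.decompose A.part).injective (DFinsupp.ext fun n => Subtype.ext (h n))

theorem proj_one_of_pos {n : ℕ} (hn : 0 < n) : A.proj n 1 = 0 :=
  proj_of_mem_of_ne SetLike.GradedOne.one_mem hn.ne

theorem one_mem_part_zero : (1 : A) ∈ A.part 0 := SetLike.GradedOne.one_mem

@[elab_as_elim]
theorem part_induction {P : A → Prop} (zero : P 0) (mem : ∀ n, ∀ a ∈ A.part n, P a)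
    (add : ∀ a b, P a → P b → P (a + b)) (a : A) : P a := by
  have ha : a ∈ ⨆ n, A.part n := A.internal.submodule_iSup_eq_top ▸ Submodule.mem_top
  induction ha using Submodule.iSup_induction' with
  | zero => exact zero
  | add b c _ _ hb hc => exact add b c hb hc
  | mem i b hb => exact mem i b hb

theorem mem_maxIdeal_iff {a : A} : a ∈ A.maxIdeal ↔ A.proj 0 a = 0 :=
  HomogeneousIdeal.mem_irrelevant_iff A.part a

theorem mem_maxIdeal_of_mem_part {n : ℕ} (hn : 0 < n) {a : A} (ha : a ∈ A.part n) :
    a ∈ A.maxIdeal :=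
  HomogeneousIdeal.mem_irrelevant_of_mem A.part hn ha

theorem sub_proj_zero_mem_aug (a : A) : a - A.proj 0 a ∈ A.aug := by
  induction a using part_induction with
  | zero => simp
  | add a b ha hb => simpa only [map_add, add_sub_add_comm] using A.aug.add_mem ha hb
  | mem n a ha =>
    cases n with
    | zero => simp [proj_of_mem ha]
    | succ n =>
      rw [proj_of_mem_of_ne ha n.succ_ne_zero, sub_zero]
      exact Submodule.mem_iSup_of_mem n ha

theorem mem_aug_iff {a : A} : a ∈ A.aug ↔ a ∈ A.maxIdeal := by
  have hle : A.aug ≤ A.maxIdeal.restrictScalars k :=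
    iSup_le fun n _ ha => mem_maxIdeal_of_mem_part n.succ_pos ha
  refine ⟨fun h => hle h, fun h => ?_⟩
  simpa only [mem_maxIdeal_iff.1 h, sub_zero] using sub_proj_zero_mem_aug a

@[elab_as_elim]
theorem maxIdeal_induction {P : (a : A) → a ∈ A.maxIdeal → Prop} (zero : P 0 (zero_mem _))
    (mem : ∀ n (hn : 0 < n) a (ha : a ∈ A.part n), P a (mem_maxIdeal_of_mem_part hn ha))
    (add : ∀ a b ha hb, P a ha → P b hb → P (a + b) (add_mem ha hb)) {a : A}
    (ha : a ∈ A.maxIdeal) : P a ha := by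
  suffices h : ∀ b (hb : b ∈ A.aug), P b (mem_aug_iff.1 hb) from h a (mem_aug_iff.2 ha)
  intro b hb
  induction hb using Submodule.iSup_induction' with
  | zero => exact zero
  | add b c _ _ hb hc => exact add b c _ _ hb hc
  | mem n b hb => exact mem _ n.succ_pos b hb

theorem exists_algebraMap_eq_of_mem_part_zero {a : A} (ha : a ∈ A.part 0) :
    ∃ c : k, algebraMap k A c = a := by
  rwa [A.connected, Submodule.mem_one] at ha

theorem algebraMap_mem_part_zero (c : k) : algebraMap k A c ∈ A.part 0 := by
  rw [A.connected, Submodule.mem_one]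
  exact ⟨c, rfl⟩

theorem exists_eq_algebraMap_add (a : A) :
    ∃ c : k, ∃ b ∈ A.maxIdeal, a = algebraMap k A c + b := by
  obtain ⟨c, hc⟩ := exists_algebraMap_eq_of_mem_part_zero (proj_mem 0 a)
  exact ⟨c, a - A.proj 0 a, mem_aug_iff.1 (sub_proj_zero_mem_aug a), by rw [hc]; abel⟩

theorem maxIdeal_sq_isHomogeneous : (A.maxIdeal ^ 2).IsHomogeneous A.part := by
  have h : A.maxIdeal.IsHomogeneous A.part :=
    (HomogeneousIdeal.irrelevant A.part).isHomogeneous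
  rw [pow_two]
  exact h.mul h

theorem proj_eq_zero_of_mem_maxIdeal_pow {j n : ℕ} (hn : n < j) {a : A}
    (ha : a ∈ A.maxIdeal ^ j) : A.proj n a = 0 := by
  induction j generalizing n a with
  | zero => exact absurd hn n.not_lt_zero
  | succ j ih =>
    rw [pow_succ] at ha
    induction ha using Submodule.mul_induction_on' with
    | add x _ y _ hx hy => rw [map_add, hx, hy, add_zero]
    | mem_mul_mem x hx y hy =>
      induction hy using maxIdeal_induction with
      | zero => rw [mul_zero, map_zero]
      | add y z _ _ hy hz => rw [mul_add, map_add, hy, hz, add_zero]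
      | mem i hi y hy =>
        rw [proj, GradedAlgebra.proj_apply, DirectSum.coe_decompose_mul_of_right_mem _ _ hy]
        split_ifs with hin
        · exact mul_eq_zero_of_left (ih (by omega) hx) y
        · rfl

theorem eq_zero_of_mem_part_of_mem_maxIdeal_pow {n : ℕ} {a : A} (ha : a ∈ A.part n)
    (ha' : a ∈ A.maxIdeal ^ (n + 1)) : a = 0 := by
  rw [← proj_of_mem ha, proj_eq_zero_of_mem_maxIdeal_pow n.lt_succ_self ha']

theorem eq_zero_of_forall_mem_maxIdeal_pow {a : A} (ha : ∀ j, a ∈ A.maxIdeal ^ j) : a = 0 :=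
  eq_of_forall_proj_eq fun n => by
    rw [proj_eq_zero_of_mem_maxIdeal_pow n.lt_succ_self (ha (n + 1)), map_zero]

theorem algebraMap_quotient_maxIdeal_bijective :
    Function.Bijective (Algebra.ofId k (A ⧸ A.maxIdeal)) := by
  refine ⟨?_, fun x => ?_⟩
  · have : Nontrivial (A ⧸ A.maxIdeal) := by
      refine Ideal.Quotient.nontrivial_iff.2 ((Ideal.ne_top_iff_one _).2 fun h => ?_)
      rw [mem_maxIdeal_iff, proj_of_mem one_mem_part_zero] at h
      exact one_ne_zero h
    exact (algebraMap k (A ⧸ A.maxIdeal)).injective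
  · obtain ⟨a, rfl⟩ := Ideal.Quotient.mk_surjective x
    obtain ⟨c, b, hb, rfl⟩ := exists_eq_algebraMap_add a
    exact ⟨c, (Ideal.Quotient.eq.2 (by simpa using hb)).symm⟩

variable (A) in
/-- The augmentation `A → A / m_A = k`. -/
def augmentation : A →ₐ[k] k :=
  ((AlgEquiv.ofBijective _ (algebraMap_quotient_maxIdeal_bijective (A := A))).symm :
    (A ⧸ A.maxIdeal) →ₐ[k] k).comp (Ideal.Quotient.mkₐ k A.maxIdeal)

theorem augmentation_of_mem_maxIdeal {a : A} (ha : a ∈ A.maxIdeal) : A.augmentation a = 0 := by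
  have h : Ideal.Quotient.mkₐ k A.maxIdeal a = 0 := Ideal.Quotient.eq_zero_iff_mem.2 ha
  rw [augmentation, AlgHom.comp_apply, h, map_zero]

/-! ### Quotients -/

/-- The quotient of a weighted algebra by a homogeneous ideal contained in the augmentation
ideal. -/
def quot (A : WeightedAlgebra k) (I : Ideal A) (hI : I.IsHomogeneous A.part)
    (hle : I ≤ A.maxIdeal) : WeightedAlgebra k where
  carrier := A ⧸ I
  nontrivial := by
    refine Ideal.Quotient.nontrivial_iff.2 ((Ideal.ne_top_iff_one _).2 fun h => ?_)
    have h1 := mem_maxIdeal_iff.1 (hle h)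
    rw [proj_of_mem one_mem_part_zero] at h1
    exact one_ne_zero h1
  part n := (A.part n).map (Ideal.Quotient.mkₐ k I).toLinearMap
  gradedMonoid :=
    { one_mem := ⟨1, SetLike.GradedOne.one_mem, map_one (Ideal.Quotient.mkₐ k I)⟩
      mul_mem := by
        rintro i j _ _ ⟨a, ha, rfl⟩ ⟨b, hb, rfl⟩
        exact ⟨a * b, SetLike.GradedMul.mul_mem ha hb, map_mul (Ideal.Quotient.mkₐ k I) a b⟩ }
  internal := by
    let e := Submodule.Quotient.restrictScalarsEquiv k I
    let π : ℕ → (A ⧸ I) →ₗ[k] (A ⧸ I) := fun n => e.toLinearMap ∘ₗ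
      (Submodule.mapQ (I.restrictScalars k) (I.restrictScalars k) (A.proj n)
        fun a ha => hI n ha) ∘ₗ e.symm.toLinearMap
    have hπ : ∀ n a, π n (Ideal.Quotient.mkₐ k I a) = Ideal.Quotient.mkₐ k I (A.proj n a) :=
      fun n a => rfl
    refine isInternal_of_proj _ π ?_ ?_ ?_
    · rintro n _ ⟨a, ha, rfl⟩
      rw [AlgHom.toLinearMap_apply, hπ, proj_of_mem ha]
    · rintro m n hmn _ ⟨a, ha, rfl⟩
      rw [AlgHom.toLinearMap_apply, hπ, proj_of_mem_of_ne ha hmn, map_zero]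
    · rw [← Submodule.map_iSup, A.internal.submodule_iSup_eq_top, Submodule.map_top,
        LinearMap.range_eq_top]
      exact Ideal.Quotient.mkₐ_surjective k I
  connected := by
    rw [A.connected, Submodule.one_eq_range, Submodule.one_eq_range, ← LinearMap.range_comp]
    rfl

/-- The projection to a quotient. -/
def mkQuot (I : Ideal A) (hI : I.IsHomogeneous A.part) (hle : I ≤ A.maxIdeal) :
    WHom A (A.quot I hI hle) where
  toAlgHom := Ideal.Quotient.mkₐ k I
  map_mem _ a ha := ⟨a, ha, rfl⟩

section

variable {I : Ideal A} {hI : I.IsHomogeneous A.part} {hle : I ≤ A.maxIdeal}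

theorem mkQuot_surjective : Function.Surjective (mkQuot I hI hle) :=
  Ideal.Quotient.mkₐ_surjective k I

theorem mkQuot_eq_iff {a b : A} : mkQuot I hI hle a = mkQuot I hI hle b ↔ a - b ∈ I :=
  Ideal.Quotient.eq

theorem exists_mem_part_of_mem_part_quot {n : ℕ} {x : A.quot I hI hle}
    (hx : x ∈ (A.quot I hI hle).part n) : ∃ a ∈ A.part n, mkQuot I hI hle a = x := hx

/-- The factorization of a morphism that kills `I` through the quotient by `I`. -/
def liftQuot (f : WHom A B) (hf : ∀ a ∈ I, f a = 0) : WHom (A.quot I hI hle) B where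
  toAlgHom := Ideal.Quotient.liftₐ I f.toAlgHom hf
  map_mem := by
    rintro n _ ⟨a, ha, rfl⟩
    exact f.map_mem n a ha

theorem exists_mem_maxIdeal_of_mem_maxIdeal_quot {x : A.quot I hI hle}
    (hx : x ∈ (A.quot I hI hle).maxIdeal) : ∃ a ∈ A.maxIdeal, mkQuot I hI hle a = x := by
  induction hx using maxIdeal_induction with
  | zero => exact ⟨0, zero_mem _, map_zero (mkQuot I hI hle).toAlgHom⟩
  | add x y _ _ hx hy =>
    obtain ⟨a, ha, rfl⟩ := hx
    obtain ⟨b, hb, rfl⟩ := hy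
    exact ⟨a + b, add_mem ha hb, map_add (mkQuot I hI hle).toAlgHom a b⟩
  | mem n hn x hx =>
    obtain ⟨a, ha, rfl⟩ := exists_mem_part_of_mem_part_quot hx
    exact ⟨a, mem_maxIdeal_of_mem_part hn ha, rfl⟩

end

/-- Products of elements of positive weight vanish. -/
def IsSquareZero (A : WeightedAlgebra k) : Prop :=
  ∀ x ∈ A.aug, ∀ y ∈ A.aug, x * y = 0

theorem IsSquareZero.mul_eq_zero (h : A.IsSquareZero) {x y : A} (hx : x ∈ A.maxIdeal)
    (hy : y ∈ A.maxIdeal) : x * y = 0 := h x (mem_aug_iff.2 hx) y (mem_aug_iff.2 hy)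

variable (A) in
/-- The first order neighbourhood `A / m²`. -/
def firstOrder : WeightedAlgebra k :=
  A.quot (A.maxIdeal ^ 2) maxIdeal_sq_isHomogeneous (Ideal.pow_le_self two_ne_zero)

variable (A) in
/-- The projection `A → A / m²`. -/
def toFirstOrder : WHom A A.firstOrder := mkQuot _ _ _

theorem toFirstOrder_surjective : Function.Surjective A.toFirstOrder := mkQuot_surjective

theorem toFirstOrder_eq_iff {a b : A} :
    A.toFirstOrder a = A.toFirstOrder b ↔ a - b ∈ A.maxIdeal ^ 2 := mkQuot_eq_iff

theorem toFirstOrder_eq_zero_iff {a : A} : A.toFirstOrder a = 0 ↔ a ∈ A.maxIdeal ^ 2 :=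
  Ideal.Quotient.eq_zero_iff_mem

theorem firstOrder_isSquareZero : A.firstOrder.IsSquareZero := by
  intro x hx y hy
  obtain ⟨a, ha, rfl⟩ := exists_mem_maxIdeal_of_mem_maxIdeal_quot (mem_aug_iff.1 hx)
  obtain ⟨b, hb, rfl⟩ := exists_mem_maxIdeal_of_mem_maxIdeal_quot (mem_aug_iff.1 hy)
  have h : A.toFirstOrder (a * b) = 0 := by
    rw [toFirstOrder_eq_zero_iff, pow_two]
    exact Ideal.mul_mem_mul ha hb
  rwa [map_mul] at h

end WeightedAlgebra

/-! ### Morphisms -/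

open WeightedAlgebra

namespace WHom

variable {A B C Z : WeightedAlgebra k}

theorem ext {f g : WHom A B} (h : ∀ a, f a = g a) : f = g := by
  obtain ⟨f, _⟩ := f
  obtain ⟨g, _⟩ := g
  obtain rfl : f = g := AlgHom.ext h
  rfl

theorem ext_part {f g : WHom A B} (h : ∀ n, 0 < n → ∀ a ∈ A.part n, f a = g a) : f = g := by
  refine ext fun a => ?_
  induction a using part_induction with
  | zero => simp only [map_zero]
  | add a b ha hb => simp only [map_add, ha, hb]
  | mem n a ha =>
    rcases n.eq_zero_or_pos with rfl | hn
    · obtain ⟨c, rfl⟩ := exists_algebraMap_eq_of_mem_part_zero ha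
      simp only [AlgHom.commutes]
    · exact h n hn a ha

/-- The identity morphism. -/
protected def id (A : WeightedAlgebra k) : WHom A A where
  toAlgHom := AlgHom.id k A
  map_mem _ _ ha := ha

@[simp] theorem id_apply (a : A) : WHom.id A a = a := rfl

@[simp] theorem comp_apply (g : WHom B C) (f : WHom A B) (a : A) : g.comp f a = g (f a) := rfl

theorem congr_apply {f g : WHom A B} (h : f = g) (a : A) : f a = g a := h ▸ rfl

theorem map_proj (f : WHom A B) (n : ℕ) (a : A) : f (A.proj n a) = B.proj n (f a) := by
  induction a using part_induction with
  | zero => simp only [map_zero]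
  | add a b ha hb => simp only [map_add, ha, hb]
  | mem m a ha =>
    by_cases hmn : m = n
    · subst hmn
      rw [proj_of_mem ha, proj_of_mem (f.map_mem m a ha)]
    · rw [proj_of_mem_of_ne ha hmn, proj_of_mem_of_ne (f.map_mem m a ha) hmn, map_zero]

theorem map_mem_maxIdeal (f : WHom A B) {a : A} (ha : a ∈ A.maxIdeal) : f a ∈ B.maxIdeal := by
  rw [mem_maxIdeal_iff, ← map_proj, mem_maxIdeal_iff.1 ha, map_zero]

theorem map_mem_maxIdeal_sq (f : WHom A B) {a : A} (ha : a ∈ A.maxIdeal ^ 2) :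
    f a ∈ B.maxIdeal ^ 2 := by
  have h : A.maxIdeal ≤ B.maxIdeal.comap f.toAlgHom := fun a ha => f.map_mem_maxIdeal ha
  exact Ideal.le_comap_pow f.toAlgHom 2 (Ideal.pow_right_mono h 2 ha)

theorem toFirstOrder_congr (f : WHom A B) {a b : A} (h : A.toFirstOrder a = A.toFirstOrder b) :
    B.toFirstOrder (f a) = B.toFirstOrder (f b) := by
  rw [toFirstOrder_eq_iff] at h ⊢
  rw [← map_sub]
  exact f.map_mem_maxIdeal_sq h

theorem eq_zero_of_mem_maxIdeal_sq (hZ : Z.IsSquareZero) (f : WHom A Z) {a : A}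
    (ha : a ∈ A.maxIdeal ^ 2) : f a = 0 := by
  have h : Z.maxIdeal ^ 2 ≤ ⊥ := by
    rw [pow_two, Ideal.mul_le]
    exact fun x hx y hy => hZ.mul_eq_zero hx hy
  exact h (f.map_mem_maxIdeal_sq ha)

variable (A B) in
/-- The trivial morphism, which factors through the augmentation. -/
def trivial : WHom A B where
  toAlgHom := (Algebra.ofId k B).comp A.augmentation
  map_mem n a ha := by
    rcases n.eq_zero_or_pos with rfl | hn
    · exact algebraMap_mem_part_zero _
    · rw [AlgHom.comp_apply, augmentation_of_mem_maxIdeal (mem_maxIdeal_of_mem_part hn ha),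
        map_zero]
      exact zero_mem _

theorem trivial_of_mem_part {n : ℕ} (hn : 0 < n) {a : A} (ha : a ∈ A.part n) :
    trivial A B a = 0 := by
  rw [trivial, AlgHom.comp_apply, augmentation_of_mem_maxIdeal (mem_maxIdeal_of_mem_part hn ha),
    map_zero]

/-- The translate of a morphism to a square-zero algebra by a tangent vector of its source. -/
def translate (hZ : Z.IsSquareZero) (f : WHom A Z) (μ : A →ₗ[k] Z) (hμ₁ : μ 1 = 0)
    (hμ : ∀ n, ∀ a ∈ A.part n, μ a ∈ Z.part n) (hμ₂ : ∀ a ∈ A.maxIdeal ^ 2, μ a = 0) :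
    WHom A Z where
  toAlgHom := AlgHom.ofLinearMap (f.toAlgHom.toLinearMap + μ) (by simp [hμ₁]) fun a b => by
    have hμm : ∀ a ∈ A.maxIdeal, μ a ∈ Z.maxIdeal := fun a ha => by
      induction ha using maxIdeal_induction with
      | zero => simp only [map_zero, zero_mem]
      | add a b _ _ ha hb => rw [map_add]; exact add_mem ha hb
      | mem n hn a ha => exact mem_maxIdeal_of_mem_part hn (hμ n a ha)
    obtain ⟨c, a, ha, rfl⟩ := exists_eq_algebraMap_add a
    obtain ⟨c', b, hb, rfl⟩ := exists_eq_algebraMap_add b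
    have hab : a * b ∈ A.maxIdeal ^ 2 := pow_two A.maxIdeal ▸ Ideal.mul_mem_mul ha hb
    have hmul : (f a + μ a) * (f b + μ b) = 0 := hZ.mul_eq_zero
      (add_mem (f.map_mem_maxIdeal ha) (hμm a ha)) (add_mem (f.map_mem_maxIdeal hb) (hμm b hb))
    have hf : f a * f b = 0 := by rw [← map_mul, f.eq_zero_of_mem_maxIdeal_sq hZ hab]
    have hc : ∀ c a, μ (algebraMap k A c * a) = algebraMap k Z c * μ a := fun c a => by
      simp only [← Algebra.smul_def, map_smul]
    have hc₁ : ∀ c, μ (algebraMap k A c) = 0 := fun c => by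
      rw [Algebra.algebraMap_eq_smul_one, map_smul, hμ₁, smul_zero]
    simp only [LinearMap.add_apply, AlgHom.toLinearMap_apply, add_mul, mul_add, map_add,
      mul_comm a (algebraMap k A c'), hc, hc₁, hμ₂ _ hab, map_mul, AlgHom.commutes] at hmul ⊢
    linear_combination hf - hmul
  map_mem n a ha := add_mem (f.map_mem n a ha) (hμ n a ha)

section

variable {f : WHom A A}

theorem sub_mem_maxIdeal_pow_succ (hf : ∀ a, A.toFirstOrder (f a) = A.toFirstOrder a) {j : ℕ}
    {a : A} (ha : a ∈ A.maxIdeal ^ j) : f a - a ∈ A.maxIdeal ^ (j + 1) := by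
  have hf₂ : ∀ a, f a - a ∈ A.maxIdeal ^ 2 := fun a => toFirstOrder_eq_iff.1 (hf a)
  induction j generalizing a with
  | zero => exact Ideal.pow_le_pow_right one_le_two (hf₂ a)
  | succ j ih =>
    rw [pow_succ] at ha
    induction ha using Submodule.mul_induction_on' with
    | add x _ y _ hx hy => simpa only [map_add, add_sub_add_comm] using add_mem hx hy
    | mem_mul_mem x hx y hy =>
      have hxy : f (x * y) - x * y = (f x - x) * f y + x * (f y - y) := by rw [map_mul]; ring
      rw [hxy]
      refine add_mem ?_ ?_
      · exact pow_succ A.maxIdeal _ ▸ Ideal.mul_mem_mul (ih hx) (f.map_mem_maxIdeal hy)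
      · exact pow_add A.maxIdeal j 2 ▸ Ideal.mul_mem_mul hx (hf₂ y)

theorem bijective_of_toFirstOrder_apply_eq (hf : ∀ a, A.toFirstOrder (f a) = A.toFirstOrder a) :
    Function.Bijective f := by
  constructor
  · refine (injective_iff_map_eq_zero f.toAlgHom).2 fun a ha =>
      eq_zero_of_forall_mem_maxIdeal_pow fun j => ?_
    induction j with
    | zero => simp
    | succ j ih =>
      have h := sub_mem_maxIdeal_pow_succ hf ih
      rwa [show f a = 0 from ha, zero_sub, neg_mem_iff] at h
  · intro a
    change a ∈ f.toAlgHom.range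
    induction a using part_induction with
    | zero => exact zero_mem _
    | add a b ha hb => exact add_mem ha hb
    | mem n a ha =>
      have approx : ∀ j, ∃ b ∈ A.part n, a - f b ∈ A.maxIdeal ^ j := by
        intro j
        induction j with
        | zero => exact ⟨0, zero_mem _, by simp⟩
        | succ j ih =>
          obtain ⟨b, hb, hab⟩ := ih
          refine ⟨b + (a - f b), add_mem hb (sub_mem ha (f.map_mem n b hb)), ?_⟩
          rw [← neg_mem_iff]
          convert sub_mem_maxIdeal_pow_succ hf hab using 1
          rw [map_add]
          abel
      obtain ⟨b, hb, hab⟩ := approx (n + 1)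
      have h := eq_zero_of_mem_part_of_mem_maxIdeal_pow (sub_mem ha (f.map_mem n b hb)) hab
      exact ⟨b, (sub_eq_zero.1 h).symm⟩

end

theorem bijective_of_toFirstOrder_inverse {f : WHom A B} {g : WHom B A}
    (hgf : ∀ a, A.toFirstOrder (g (f a)) = A.toFirstOrder a)
    (hfg : ∀ b, B.toFirstOrder (f (g b)) = B.toFirstOrder b) : Function.Bijective f :=
  ⟨Function.Injective.of_comp (f := g)
      (bijective_of_toFirstOrder_apply_eq (f := g.comp f) hgf).injective,
    Function.Surjective.of_comp (g := g)
      (bijective_of_toFirstOrder_apply_eq (f := f.comp g) hfg).surjective⟩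

/-- The inverse of a bijective morphism. -/
def inverse (f : WHom A B) (hf : Function.Bijective f) : WHom B A where
  toAlgHom := (AlgEquiv.ofBijective f.toAlgHom hf).symm
  map_mem n b hb := by
    obtain ⟨a, rfl⟩ := hf.surjective b
    have ha : A.proj n a = a := hf.injective (by rw [map_proj, proj_of_mem hb])
    change (AlgEquiv.ofBijective f.toAlgHom hf).symm (f.toAlgHom a) ∈ A.part n
    rw [AlgEquiv.ofBijective_symm_apply_apply, ← ha]
    exact proj_mem n a

theorem inverse_apply_apply (f : WHom A B) (hf : Function.Bijective f) (a : A) :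
    f.inverse hf (f a) = a :=
  AlgEquiv.ofBijective_symm_apply_apply f.toAlgHom hf a

end WHom

open WeightedAlgebra

/-! ### Tangent vectors -/

variable {A B C Z : WeightedAlgebra k}

section

variable {i : ℕ} {hi : 0 < i}

theorem mem_dual_part_iff {n : ℕ} {x : dual k i hi} :
    x ∈ (dual k i hi).part n ↔
      (n ≠ 0 → TrivSqZeroExt.fst (x : DualNumber k) = 0) ∧
        (n ≠ i → TrivSqZeroExt.snd (x : DualNumber k) = 0) := Iff.rfl

theorem dual_isSquareZero : (dual k i hi).IsSquareZero := by
  have h : ∀ x ∈ (dual k i hi).aug, TrivSqZeroExt.fst (x : DualNumber k) = 0 := by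
    have hle : (dual k i hi).aug ≤ LinearMap.ker (TrivSqZeroExt.fstHom k k k).toLinearMap :=
      iSup_le fun n x hx => (mem_dual_part_iff.1 hx).1 n.succ_ne_zero
    exact fun x hx => hle hx
  have hmul : ∀ x y : DualNumber k, x.fst = 0 → y.fst = 0 → x * y = 0 := fun x y hx hy => by
    ext <;> simp [hx, hy]
  exact fun x hx y hy => hmul x y (h x hx) (h y hy)

variable (k i hi) in
/-- The coefficient of `ε`. -/
def dualSnd : dual k i hi →ₗ[k] k := TrivSqZeroExt.sndHom k k

variable (k i hi) in
/-- The inclusion of `k ε`. -/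
def dualInr : k →ₗ[k] dual k i hi := TrivSqZeroExt.inrHom k k

theorem dualSnd_dualInr (x : k) : dualSnd k i hi (dualInr k i hi x) = x :=
  TrivSqZeroExt.snd_inr k x

theorem dualInr_mem_part (x : k) : dualInr k i hi x ∈ (dual k i hi).part i :=
  mem_dual_part_iff.2 ⟨fun _ => TrivSqZeroExt.fst_inr k x, fun h => absurd rfl h⟩

variable (hi) in
/-- The tangent vector of weight `i` given by a linear form on `m / m²`. -/
def tangentVector (τ : A →ₗ[k] k) (hτ : ∀ a ∈ A.maxIdeal ^ 2, τ a = 0) :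
    WHom A (dual k i hi) :=
  (WHom.trivial A _).translate dual_isSquareZero (dualInr k i hi ∘ₗ τ ∘ₗ A.proj i)
    (by simp only [LinearMap.comp_apply, proj_one_of_pos hi, map_zero])
    (fun n a ha => by
      by_cases hn : n = i
      · exact hn ▸ dualInr_mem_part _
      · simp only [LinearMap.comp_apply, proj_of_mem_of_ne ha hn, map_zero, zero_mem])
    (fun a ha => by
      have h : A.proj i a ∈ A.maxIdeal ^ 2 := maxIdeal_sq_isHomogeneous i ha
      simp only [LinearMap.comp_apply, hτ _ h, map_zero])

theorem dualSnd_tangentVector {n : ℕ} (hn : 0 < n) {τ : A →ₗ[k] k}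
    {hτ : ∀ a ∈ A.maxIdeal ^ 2, τ a = 0} {a : A} (ha : a ∈ A.part n) :
    dualSnd k i hi (tangentVector hi τ hτ a) = τ (A.proj i a) := by
  have h : tangentVector hi τ hτ a = WHom.trivial A _ a + dualInr k i hi (τ (A.proj i a)) := rfl
  rw [h, WHom.trivial_of_mem_part hn ha, zero_add, dualSnd_dualInr]

end

theorem toFirstOrder_apply_eq_of_forall_dual {f g : WHom A B}
    (h : ∀ i (hi : 0 < i) (t : WHom B (dual k i hi)), t.comp f = t.comp g) (a : A) :
    B.toFirstOrder (f a) = B.toFirstOrder (g a) := by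
  suffices hfg : B.toFirstOrder.comp f = B.toFirstOrder.comp g from WHom.congr_apply hfg a
  refine WHom.ext_part fun n hn a ha => toFirstOrder_eq_iff.2 ?_
  by_contra hne
  obtain ⟨τ, hτ, hker⟩ := Submodule.exists_le_ker_of_notMem
    (p := (B.maxIdeal ^ 2).restrictScalars k) hne
  have hτ₂ : ∀ b ∈ B.maxIdeal ^ 2, τ b = 0 := fun b hb => hker hb
  have hfn := f.map_mem n a ha
  have hgn := g.map_mem n a ha
  have ht := congrArg (dualSnd k n hn) (WHom.congr_apply (h n hn (tangentVector hn τ hτ₂)) a)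
  rw [WHom.comp_apply, WHom.comp_apply, dualSnd_tangentVector hn hfn,
    dualSnd_tangentVector hn hgn, proj_of_mem hfn, proj_of_mem hgn] at ht
  exact hτ ((map_sub τ _ _).trans (sub_eq_zero.2 ht))

/-! ### Morphisms out of tensor products and polynomial algebras -/

/-- The inclusion `C → B ⊗ C` of the second factor. -/
def tensorInr (B C : WeightedAlgebra k) : WHom C (tensor B C) where
  toAlgHom := (Algebra.TensorProduct.includeRight : C →ₐ[k] B ⊗[k] C)
  map_mem n c hc := by
    change (1 : B) ⊗ₜ[k] c ∈ tensorPart B C n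
    exact Submodule.subset_span ⟨0, n, zero_add n, 1, SetLike.GradedOne.one_mem, c, hc, rfl⟩

/-- The morphism from a tensor product given by morphisms from the factors. -/
def WHom.tensorLift (f : WHom B Z) (g : WHom C Z) : WHom (tensor B C) Z where
  toAlgHom := (Algebra.TensorProduct.productMap f.toAlgHom g.toAlgHom : B ⊗[k] C →ₐ[k] Z)
  map_mem n := by
    let φ := Algebra.TensorProduct.productMap f.toAlgHom g.toAlgHom
    have hle : tensorPart B C n ≤ (Z.part n).comap φ.toLinearMap := by
      refine Submodule.span_le.2 ?_
      rintro x ⟨i, j, rfl, b, hb, c, hc, rfl⟩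
      change φ (b ⊗ₜ[k] c) ∈ Z.part (i + j)
      rw [Algebra.TensorProduct.productMap_apply_tmul]
      exact SetLike.GradedMul.mul_mem (f.map_mem i b hb) (g.map_mem j c hc)
    exact fun x hx => hle hx

@[simp]
theorem WHom.tensorLift_inl (f : WHom B Z) (g : WHom C Z) (b : B) :
    f.tensorLift g (tensorInl B C b) = f b :=
  Algebra.TensorProduct.productMap_left_apply f.toAlgHom g.toAlgHom b

@[simp]
theorem WHom.tensorLift_inr (f : WHom B Z) (g : WHom C Z) (c : C) :
    f.tensorLift g (tensorInr B C c) = g c :=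
  Algebra.TensorProduct.productMap_right_apply f.toAlgHom g.toAlgHom c

theorem WHom.tensor_ext {f g : WHom (tensor B C) Z}
    (hl : ∀ b, f (tensorInl B C b) = g (tensorInl B C b))
    (hr : ∀ c, f (tensorInr B C c) = g (tensorInr B C c)) : f = g := by
  have h : f.toAlgHom = g.toAlgHom :=
    Algebra.TensorProduct.ext (A := B) (B := C) (AlgHom.ext hl) (AlgHom.ext hr)
  exact WHom.ext fun a => congrArg (fun φ => φ a) h

section

variable {σ : Type u} {c : σ → ℕ} {hc : ∀ s, 0 < c s}

variable (hc) in
/-- The generators of a weighted polynomial algebra. -/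
def polyVar (s : σ) : poly k c hc := (MvPolynomial.X s : MvPolynomial σ k)

theorem polyVar_mem_part (s : σ) : polyVar hc s ∈ (poly k c hc).part (c s) :=
  MvPolynomial.isWeightedHomogeneous_X k c s

/-- The morphism from a polynomial algebra given by the images of the generators. -/
def polyLift (l : σ → A) (hl : ∀ s, l s ∈ A.part (c s)) : WHom (poly k c hc) A where
  toAlgHom := (MvPolynomial.aeval l : MvPolynomial σ k →ₐ[k] A)
  map_mem n := by
    intro (p : MvPolynomial σ k) (hp : MvPolynomial.IsWeightedHomogeneous c p n)
    change MvPolynomial.aeval l p ∈ A.part n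
    rw [MvPolynomial.aeval_def, MvPolynomial.eval₂_eq]
    refine Submodule.sum_mem _ fun d hd => ?_
    rw [← Algebra.smul_def, ← hp (MvPolynomial.mem_support_iff.1 hd), Finsupp.weight_apply]
    exact Submodule.smul_mem _ _ (SetLike.prod_pow_mem_graded A.part _ _ _ fun s _ => hl s)

@[simp]
theorem polyLift_polyVar (l : σ → A) (hl : ∀ s, l s ∈ A.part (c s)) (s : σ) :
    polyLift (hc := hc) l hl (polyVar hc s) = l s := MvPolynomial.aeval_X l s

theorem WHom.poly_ext {f g : WHom (poly k c hc) A}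
    (h : ∀ s, f (polyVar hc s) = g (polyVar hc s)) : f = g := by
  have hfg : f.toAlgHom = g.toAlgHom := MvPolynomial.algHom_ext (σ := σ) (R := k) h
  exact WHom.ext fun a => congrArg (fun φ => φ a) hfg

end

/-! ### Homogeneous coordinates -/

/-- The subspaces `k ⊕ T'` of `A = k ⊕ m_A` such that `T'` is the preimage of a graded subspace of
`m_A / m_A²`. -/
structure IsCotangentSubspace (T : Submodule k A) : Prop where
  isHomogeneous : DirectSum.SetLike.IsHomogeneous A.part T
  one_mem : 1 ∈ T
  mem_of_mem_sq : ∀ a ∈ A.maxIdeal ^ 2, a ∈ T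

/-- Homogeneous coordinates on `A / T`, for a subspace `T`: a basis of `A / T` and a lift of it to
homogeneous elements of positive weight in `A`. -/
structure CoordinateSystem (T : Submodule k A) where
  index : Type u
  weight : index → ℕ
  weight_pos : ∀ s, 0 < weight s
  lift : index → A
  lift_mem_part : ∀ s, lift s ∈ A.part (weight s)
  basis : Module.Basis index k (A ⧸ T)
  basis_eq : ∀ s, basis s = T.mkQ (lift s)

theorem exists_coordinateSystem {T : Submodule k A} (h1 : 1 ∈ T) :
    Nonempty (CoordinateSystem T) := by
  let G : Set (A ⧸ T) := {x | ∃ n, 0 < n ∧ ∃ a ∈ A.part n, T.mkQ a = x}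
  have hspan : ⊤ ≤ Submodule.span k G := by
    suffices h : ∀ a, T.mkQ a ∈ Submodule.span k G by
      intro x _
      obtain ⟨a, rfl⟩ := T.mkQ_surjective x
      exact h a
    intro a
    induction a using part_induction with
    | zero => simp only [map_zero, zero_mem]
    | add a b ha hb => simpa only [map_add] using add_mem ha hb
    | mem n a ha =>
      rcases n.eq_zero_or_pos with rfl | hn
      · obtain ⟨c, rfl⟩ := exists_algebraMap_eq_of_mem_part_zero ha
        have hc : algebraMap k A c ∈ T := by
          rw [Algebra.algebraMap_eq_smul_one]
          exact T.smul_mem c h1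
        rw [Submodule.mkQ_apply, (Submodule.Quotient.mk_eq_zero T).2 hc]
        exact zero_mem _
      · exact Submodule.subset_span ⟨n, hn, a, ha, rfl⟩
  let basis := Module.Basis.ofSpan hspan
  choose weight weight_pos lift lift_mem_part hlift using fun s =>
    Module.Basis.ofSpan_subset hspan ⟨s, rfl⟩
  exact ⟨⟨_, weight, weight_pos, lift, lift_mem_part, basis, fun s => (hlift s).symm⟩⟩

namespace CoordinateSystem

variable {T : Submodule k A} (S : CoordinateSystem T)

/-- The coordinates of an element of `A`. -/
def coord : A →ₗ[k] S.index →₀ k := S.basis.repr.toLinearMap ∘ₗ T.mkQ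

/-- The linear combination of the lifts with given coefficients. -/
def combination : (S.index →₀ k) →ₗ[k] A := Finsupp.linearCombination k S.lift

theorem coord_eq_zero {a : A} (ha : a ∈ T) : S.coord a = 0 := by
  rw [coord, LinearMap.comp_apply, Submodule.mkQ_apply, (Submodule.Quotient.mk_eq_zero T).2 ha,
    map_zero]

@[simp]
theorem coord_lift (s : S.index) : S.coord (S.lift s) = Finsupp.single s 1 := by
  rw [coord, LinearMap.comp_apply, ← S.basis_eq, LinearEquiv.coe_coe, S.basis.repr_self]

@[simp]
theorem combination_single (s : S.index) (x : k) :
    S.combination (Finsupp.single s x) = x • S.lift s :=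
  Finsupp.linearCombination_single k x s

theorem coord_combination (x : S.index →₀ k) : S.coord (S.combination x) = x := by
  induction x using Finsupp.induction_linear with
  | zero => simp only [map_zero]
  | add x y hx hy => rw [map_add, map_add, hx, hy]
  | single s c => simp

theorem sub_combination_coord_mem (a : A) : a - S.combination (S.coord a) ∈ T := by
  have h : S.basis.repr (T.mkQ (a - S.combination (S.coord a))) = 0 := by
    change S.coord _ = 0
    rw [map_sub, coord_combination, sub_self]
  rwa [map_eq_zero_iff _ S.basis.repr.injective, Submodule.mkQ_apply,
    Submodule.Quotient.mk_eq_zero] at h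

theorem proj_combination (n : ℕ) (x : S.index →₀ k) :
    A.proj n (S.combination x) = S.combination (x.filter (S.weight · = n)) := by
  induction x using Finsupp.induction_linear with
  | zero => simp only [map_zero, Finsupp.filter_zero]
  | add x y hx hy => rw [map_add, map_add, hx, hy, Finsupp.filter_add, map_add]
  | single s c =>
    by_cases hs : S.weight s = n
    · rw [Finsupp.filter_single_of_pos (S.weight · = n) hs, combination_single, map_smul,
        proj_of_mem (hs ▸ S.lift_mem_part s)]
    · rw [Finsupp.filter_single_of_neg (S.weight · = n) hs, combination_single, map_smul,
        proj_of_mem_of_ne (S.lift_mem_part s) hs, smul_zero, map_zero]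

theorem weight_eq_of_coord_ne_zero (hT : DirectSum.SetLike.IsHomogeneous A.part T) {n : ℕ} {a : A}
    (ha : a ∈ A.part n) {s : S.index} (hs : S.coord a s ≠ 0) : S.weight s = n := by
  have h : A.proj n (a - S.combination (S.coord a)) ∈ T :=
    hT n (S.sub_combination_coord_mem a)
  rw [map_sub, proj_of_mem ha, proj_combination] at h
  have hcoord := S.coord_eq_zero h
  rw [map_sub, coord_combination, sub_eq_zero] at hcoord
  rw [hcoord] at hs
  exact (Finsupp.mem_support_iff.2 hs |> fun h => Finset.mem_filter.1 h).2

/-- The weighted polynomial algebra on the coordinates. -/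
abbrev poly : WeightedAlgebra k := WeightedDeformation.poly k S.weight S.weight_pos

/-- The coordinates of an element of `A`, as a linear form in the polynomial ring. -/
def linearForm : A →ₗ[k] S.poly :=
  Finsupp.linearCombination k (polyVar S.weight_pos) ∘ₗ S.coord

theorem linearForm_eq_zero {a : A} (ha : a ∈ T) : S.linearForm a = 0 := by
  rw [linearForm, LinearMap.comp_apply, S.coord_eq_zero ha, map_zero]

@[simp]
theorem linearForm_lift (s : S.index) : S.linearForm (S.lift s) = polyVar S.weight_pos s := by
  rw [linearForm, LinearMap.comp_apply, coord_lift, Finsupp.linearCombination_single, one_smul]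

theorem linearForm_mem_part (hT : DirectSum.SetLike.IsHomogeneous A.part T) {n : ℕ} {a : A}
    (ha : a ∈ A.part n) : S.linearForm a ∈ S.poly.part n := by
  refine Submodule.sum_mem _ fun s hs => Submodule.smul_mem _ _ ?_
  rw [← S.weight_eq_of_coord_ne_zero hT ha (Finsupp.mem_support_iff.1 hs)]
  exact polyVar_mem_part s

theorem apply_linearForm {V : Type*} [AddCommGroup V] [Module k V] (ψ : S.poly →ₗ[k] V)
    (χ : A →ₗ[k] V) (h : ∀ s, ψ (polyVar S.weight_pos s) = χ (S.lift s)) (a : A) :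
    ψ (S.linearForm a) = χ (S.combination (S.coord a)) := by
  simp only [linearForm, combination, LinearMap.comp_apply, Finsupp.apply_linearCombination]
  congr 2
  exact funext h

/-- The first order deformation `a ↦ f a ⊗ 1 + 1 ⊗ (coordinates of a)` of a morphism `f`. -/
def firstOrderGraph (hT : IsCotangentSubspace T) (f : WHom A B) :
    WHom A (tensor B S.poly).firstOrder :=
  ((tensor B S.poly).toFirstOrder.comp ((tensorInl B S.poly).comp f)).translate
    firstOrder_isSquareZero
    (((tensor B S.poly).toFirstOrder.comp (tensorInr B S.poly)).toAlgHom.toLinearMap ∘ₗ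
      S.linearForm)
    (by rw [LinearMap.comp_apply, S.linearForm_eq_zero hT.one_mem, map_zero])
    (fun n _ ha => ((tensor B S.poly).toFirstOrder.comp (tensorInr B S.poly)).map_mem n _
      (S.linearForm_mem_part hT.isHomogeneous ha))
    (fun a ha => by
      rw [LinearMap.comp_apply, S.linearForm_eq_zero (hT.mem_of_mem_sq a ha), map_zero])

theorem firstOrderGraph_apply (hT : IsCotangentSubspace T) (f : WHom A B) (a : A) :
    S.firstOrderGraph hT f a = (tensor B S.poly).toFirstOrder
      (tensorInl B S.poly (f a) + tensorInr B S.poly (S.linearForm a)) :=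
  (map_add (tensor B S.poly).toFirstOrder.toAlgHom _ _).symm

end CoordinateSystem

/-! ### Pullback and versality -/

variable {R : WeightedDGCA.{u, v} k}

theorem WeightedDGCA.part_induction {P : R → Prop} (zero : P 0)
    (mem : ∀ n w, ∀ a ∈ R.part (n, w), P a) (add : ∀ a b, P a → P b → P (a + b)) (a : R) : P a := by
  have ha : a ∈ ⨆ p, R.part p := by
    rw [R.internal.submodule_iSup_eq_top]
    trivial
  induction ha using Submodule.iSup_induction' with
  | zero => exact zero
  | add b c _ _ hb hc => exact add b c hb hc
  | mem p b hb => exact mem p.1 p.2 b hb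

namespace Deformation

theorem ext_e {E F : Deformation R B} (h : ∀ r, E.e r = F.e r) : E = F := by
  cases E
  cases F
  congr 1
  exact LinearMap.ext h

theorem baseMap_comp (g : WHom B C) (f : WHom A B) (x : A ⊗[k] R) :
    baseMap R (g.comp f) x = baseMap R g (baseMap R f x) := by
  induction x using TensorProduct.induction_on with
  | zero => simp only [map_zero]
  | add x y hx hy => simp only [map_add, hx, hy]
  | tmul a r => simp only [baseMap_tmul, WHom.comp_apply]

theorem baseMap_id (x : A ⊗[k] R) : baseMap R (WHom.id A) x = x := by
  induction x using TensorProduct.induction_on with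
  | zero => exact map_zero _
  | add x y hx hy => rw [map_add, hx, hy]
  | tmul a r => rw [baseMap_tmul, WHom.id_apply]

theorem map_map (E : Deformation R A) (f : WHom A B) (g : WHom B C) :
    (E.map f).map g = E.map (g.comp f) :=
  ext_e fun r => (baseMap_comp g f (E.e r)).symm

theorem map_id (E : Deformation R A) : E.map (WHom.id A) = E := ext_e fun r => baseMap_id (E.e r)

theorem classify_eq_iff {E : Deformation R A} {f g : WHom A B} :
    E.classify B f = E.classify B g ↔ IsIso (E.map f) (E.map g) :=
  ⟨fun h => Quotient.exact h, fun h => Quotient.sound h⟩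

theorem IsVersal.exists_lift {E : Deformation R A} (hE : E.IsVersal) {B' : WeightedAlgebra k}
    (p : WHom B B') (hp : Function.Surjective p) (hB' : B'.IsSquareZero) (f' : WHom A B')
    (G : Deformation R B) (h : IsIso (E.map f') (G.map p)) :
    ∃ f : WHom A B, p.comp f = f' ∧ IsIso (E.map f) G := by
  obtain ⟨f, hf, hfG⟩ := hE B B' p hp hB' f' (Quotient.mk _ G) (Quotient.sound h)
  exact ⟨f, hf, Quotient.exact hfG⟩

theorem isVersal_of_exists_lift {E : Deformation R A}
    (h : ∀ (B B' : WeightedAlgebra k) (p : WHom B B'), Function.Surjective p →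
      B'.IsSquareZero → ∀ (f' : WHom A B') (G : Deformation R B),
      IsIso (E.map f') (G.map p) → ∃ f : WHom A B, p.comp f = f' ∧ IsIso (E.map f) G) :
    E.IsVersal := by
  intro B B' p hp hB' f' m hm
  induction m using Quotient.inductionOn with
  | _ G =>
    obtain ⟨f, hf, hfG⟩ := h B B' p hp hB' f' G (Quotient.exact hm)
    exact ⟨f, hf, Quotient.sound hfG⟩

theorem eq_of_maxIdeal_eq_bot (hB : B.maxIdeal = ⊥) (E F : Deformation R B) : E = F := by
  have hlow : ∀ n w, ∀ x ∈ lowPart R B n w, x = 0 := by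
    intro n w x hx
    refine (Submodule.mem_bot k).1 (Submodule.span_le.2 ?_ hx)
    rintro _ ⟨i, j, hi, -, b, hb, r, -, rfl⟩
    have hb₀ : b = 0 := by simpa only [hB, Ideal.mem_bot] using mem_maxIdeal_of_mem_part hi hb
    simp only [hb₀, TensorProduct.zero_tmul, SetLike.mem_coe, Submodule.zero_mem]
  refine ext_e fun r => ?_
  induction r using WeightedDGCA.part_induction with
  | zero => simp only [map_zero]
  | add r s hr hs => rw [map_add, map_add, hr, hs]
  | mem n w r hr => rw [hlow _ _ _ (E.mem_lowPart n w r hr), hlow _ _ _ (F.mem_lowPart n w r hr)]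

theorem IsVersal.exists_isIso {E : Deformation R A} (hE : E.IsVersal) (G : Deformation R B) :
    ∃ f : WHom A B, IsIso (E.map f) G := by
  let p : WHom B _ := mkQuot B.maxIdeal (HomogeneousIdeal.irrelevant B.part).isHomogeneous le_rfl
  have hbot : (B.quot _ (HomogeneousIdeal.irrelevant B.part).isHomogeneous le_rfl).maxIdeal = ⊥ :=
    eq_bot_iff.2 fun x hx => by
      obtain ⟨b, hb, rfl⟩ := exists_mem_maxIdeal_of_mem_maxIdeal_quot hx
      exact Ideal.Quotient.eq_zero_iff_mem.2 hb
  have hsq : (B.quot _ (HomogeneousIdeal.irrelevant B.part).isHomogeneous le_rfl).IsSquareZero :=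
    fun x hx y _ => by
      rw [mem_aug_iff, hbot, Ideal.mem_bot] at hx
      rw [hx, zero_mul]
  obtain ⟨f, -, hf⟩ := hE.exists_lift p mkQuot_surjective hsq (WHom.trivial A _) G
    (eq_of_maxIdeal_eq_bot hbot (E.map _) (G.map p) ▸ IsIso.refl _)
  exact ⟨f, hf⟩

/-! ### Isomorphisms over a square zero base -/

/-- The submodule `m_Z ⊗ R` of `Z ⊗ R`. -/
def augPart (R : WeightedDGCA.{u, v} k) (Z : WeightedAlgebra k) : Submodule Z (Z ⊗[k] R) :=
  Z.maxIdeal • ⊤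

theorem mem_augPart_of_mem_lowPart {n w : ℕ} {x : Z ⊗[k] R} (hx : x ∈ lowPart R Z n w) :
    x ∈ augPart R Z := by
  have htmul : ∀ z ∈ Z.maxIdeal, ∀ r : R, z ⊗ₜ[k] r ∈ augPart R Z := fun z hz r => by
    rw [← mul_one z, ← smul_eq_mul, ← TensorProduct.smul_tmul']
    exact Submodule.smul_mem_smul hz Submodule.mem_top
  have hle : lowPart R Z n w ≤ (augPart R Z).restrictScalars k := by
    refine Submodule.span_le.2 ?_
    rintro _ ⟨i, j, hi, -, z, hz, r, -, rfl⟩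
    exact htmul z (mem_maxIdeal_of_mem_part hi hz) r
  exact hle hx

theorem mem_augPart_of_forall_part {θ : R →ₗ[k] Z ⊗[k] R} {deg : ℕ → ℕ}
    (hθ : ∀ n w, ∀ r ∈ R.part (n, w), θ r ∈ lowPart R Z (deg n) w) (r : R) :
    θ r ∈ augPart R Z := by
  induction r using WeightedDGCA.part_induction with
  | zero => simp only [map_zero, zero_mem]
  | mem n w r hr => exact mem_augPart_of_mem_lowPart (hθ n w r hr)
  | add r s hr hs => simpa only [map_add] using add_mem hr hs

theorem e_mem_augPart (E : Deformation R Z) (r : R) : E.e r ∈ augPart R Z :=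
  mem_augPart_of_forall_part E.mem_lowPart r

theorem mul_eq_zero_of_mem_augPart (hZ : Z.IsSquareZero) {x y : Z ⊗[k] R}
    (hx : x ∈ augPart R Z) (hy : y ∈ augPart R Z) : x * y = 0 := by
  induction hx using Submodule.smul_induction_on' with
  | add x _ x' _ h h' => rw [add_mul, h, h', add_zero]
  | smul z hz x _ =>
    induction hy using Submodule.smul_induction_on' with
    | add y _ y' _ h h' => rw [mul_add, h, h', add_zero]
    | smul z' hz' y _ => rw [smul_mul_smul_comm, hZ.mul_eq_zero hz hz', zero_smul]

theorem eq_zero_of_mem_augPart (hZ : Z.IsSquareZero) {ψ : Z ⊗[k] R →ₗ[Z] Z ⊗[k] R}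
    (hψ : ∀ r : R, ψ (1 ⊗ₜ r) ∈ augPart R Z) {x : Z ⊗[k] R} (hx : x ∈ augPart R Z) : ψ x = 0 := by
  have hrange : ∀ x, ψ x ∈ augPart R Z := fun x => by
    induction x using TensorProduct.induction_on with
    | zero => simp only [map_zero, zero_mem]
    | add x y hx hy => simpa only [map_add] using add_mem hx hy
    | tmul z r =>
      rw [← mul_one z, ← smul_eq_mul, ← TensorProduct.smul_tmul', map_smul]
      exact Submodule.smul_mem _ z (hψ r)
  have hsmul : ∀ z ∈ Z.maxIdeal, ∀ y ∈ augPart R Z, z • y = 0 := fun z hz y hy => by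
    induction hy using Submodule.smul_induction_on' with
    | add y _ y' _ h h' => rw [smul_add, h, h', add_zero]
    | smul z' hz' y _ => rw [smul_smul, hZ.mul_eq_zero hz hz', zero_smul]
  induction hx using Submodule.smul_induction_on' with
  | add x _ y _ h h' => rw [map_add, h, h', add_zero]
  | smul z hz x _ => rw [map_smul, hsmul z hz _ (hrange x)]

theorem D_one_tmul (E : Deformation R Z) (r : R) : E.D (1 ⊗ₜ r) = 1 ⊗ₜ R.d r + E.e r := by
  rw [D, totalD, LinearMap.add_apply, LinearMap.baseChange_tmul, LinearMap.liftBaseChange_tmul,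
    one_smul]

theorem D_of_mem_augPart (hZ : Z.IsSquareZero) (E : Deformation R Z) {x : Z ⊗[k] R}
    (hx : x ∈ augPart R Z) : E.D x = R.d.lTensor Z x := by
  have h : E.e.liftBaseChange Z x = 0 := eq_zero_of_mem_augPart hZ
    (fun r => by simpa only [LinearMap.liftBaseChange_tmul, one_smul] using E.e_mem_augPart r) hx
  rw [D, totalD, LinearMap.add_apply, h, add_zero]
  rfl

end Deformation

section

variable (R : WeightedDGCA.{u, v} k) (Y : Type*) [AddCommGroup Y] [Module k Y]

/-- The derivations of degree zero of `R` with values in the bimodule `Y ⊗ R`. -/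
def derivations : Submodule k (R →ₗ[k] Y ⊗[k] R) where
  carrier := {θ | ∀ r s, θ (r * s) =
    (LinearMap.mulRight k s).lTensor Y (θ r) + (LinearMap.mulLeft k r).lTensor Y (θ s)}
  zero_mem' r s := by simp only [LinearMap.zero_apply, map_zero, add_zero]
  add_mem' hθ hη r s := by
    simp only [LinearMap.add_apply, hθ r s, hη r s, map_add]
    abel
  smul_mem' c θ hθ r s := by simp only [LinearMap.smul_apply, hθ r s, map_smul, smul_add]

/-- The commutator `θ ↦ [d, θ]` on linear maps `R → Y ⊗ R` of degree zero. -/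
def coboundary : (R →ₗ[k] Y ⊗[k] R) →ₗ[k] R →ₗ[k] Y ⊗[k] R :=
  LinearMap.llcomp k R (Y ⊗[k] R) (Y ⊗[k] R) (R.d.lTensor Y) - LinearMap.lcomp k (Y ⊗[k] R) R.d

end

@[simp]
theorem coboundary_apply {Y : Type*} [AddCommGroup Y] [Module k Y] (θ : R →ₗ[k] Y ⊗[k] R) (r : R) :
    coboundary R Y θ r = R.d.lTensor Y (θ r) - θ (R.d r) := rfl

theorem lTensor_mulRight_apply (s : R) (x : Z ⊗[k] R) :
    (LinearMap.mulRight k s).lTensor Z x = x * 1 ⊗ₜ s := by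
  induction x using TensorProduct.induction_on with
  | zero => rw [map_zero, zero_mul]
  | add x y hx hy => rw [map_add, add_mul, hx, hy]
  | tmul z r => simp only [LinearMap.lTensor_tmul, LinearMap.mulRight_apply,
      Algebra.TensorProduct.tmul_mul_tmul, mul_one]

theorem lTensor_mulLeft_apply (r : R) (x : Z ⊗[k] R) :
    (LinearMap.mulLeft k r).lTensor Z x = 1 ⊗ₜ r * x := by
  induction x using TensorProduct.induction_on with
  | zero => rw [map_zero, mul_zero]
  | add x y hx hy => rw [map_add, mul_add, hx, hy]
  | tmul z s => simp only [LinearMap.lTensor_tmul, LinearMap.mulLeft_apply,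
      Algebra.TensorProduct.tmul_mul_tmul, one_mul]

theorem mem_derivations_iff {θ : R →ₗ[k] Z ⊗[k] R} :
    θ ∈ derivations R Z ↔ ∀ r s, θ (r * s) = θ r * 1 ⊗ₜ s + 1 ⊗ₜ r * θ s := by
  simp only [derivations, lTensor_mulRight_apply, lTensor_mulLeft_apply]
  rfl

/-- The derivations of `R` with values in `m_Z ⊗ R` that preserve the total degree and the total
weight: the infinitesimal automorphisms of the trivial family over `Spec Z`. -/
def lowDerivations (R : WeightedDGCA.{u, v} k) (Z : WeightedAlgebra k) :
    Set (R →ₗ[k] Z ⊗[k] R) :=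
  {θ | θ ∈ derivations R Z ∧ ∀ n w, ∀ r ∈ R.part (n, w), θ r ∈ lowPart R Z n w}

theorem neg_mem_lowDerivations {θ : R →ₗ[k] Z ⊗[k] R} (hθ : θ ∈ lowDerivations R Z) :
    -θ ∈ lowDerivations R Z :=
  ⟨neg_mem hθ.1, fun n w r hr => neg_mem (hθ.2 n w r hr)⟩

namespace Deformation

/-- The algebra endomorphism `exp θ = 1 + θ` of `Z ⊗ R`, for `Z` of square zero. -/
def expHom (hZ : Z.IsSquareZero) {θ : R →ₗ[k] Z ⊗[k] R} (hθ : θ ∈ lowDerivations R Z) :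
    Z ⊗[k] R →ₐ[Z] Z ⊗[k] R :=
  Algebra.TensorProduct.lift (Algebra.ofId Z (Z ⊗[k] R))
    (AlgHom.ofLinearMap
      ((Algebra.TensorProduct.includeRight : R →ₐ[k] Z ⊗[k] R).toLinearMap + θ)
      (by
        have h := mem_derivations_iff.1 hθ.1 1 1
        rw [mul_one, ← Algebra.TensorProduct.one_def, mul_one, one_mul, left_eq_add] at h
        rw [LinearMap.add_apply, h, add_zero]
        rfl)
      (fun r s => by
        have h := mul_eq_zero_of_mem_augPart hZ (mem_augPart_of_forall_part hθ.2 r)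
          (mem_augPart_of_forall_part hθ.2 s)
        simp only [LinearMap.add_apply, AlgHom.toLinearMap_apply, map_mul,
          mem_derivations_iff.1 hθ.1, mul_add, add_mul, h,
          Algebra.TensorProduct.includeRight_apply]
        abel))
    (fun z _ => Algebra.commutes z _)

variable {hZ : Z.IsSquareZero} {θ : R →ₗ[k] Z ⊗[k] R} {hθ : θ ∈ lowDerivations R Z}

theorem expHom_one_tmul (r : R) : expHom hZ hθ (1 ⊗ₜ r) = 1 ⊗ₜ r + θ r := by
  refine (Algebra.TensorProduct.lift_tmul _ _ _ _ _).trans ?_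
  rw [map_one, one_mul]
  rfl

theorem eq_self_of_mem_augPart (hZ : Z.IsSquareZero) {φ : Z ⊗[k] R →ₗ[Z] Z ⊗[k] R}
    (hφ : ∀ r : R, φ (1 ⊗ₜ r) - 1 ⊗ₜ r ∈ augPart R Z) {x : Z ⊗[k] R} (hx : x ∈ augPart R Z) :
    φ x = x :=
  sub_eq_zero.1 (eq_zero_of_mem_augPart (ψ := φ - LinearMap.id) hZ hφ hx)

theorem expHom_of_mem_augPart {x : Z ⊗[k] R} (hx : x ∈ augPart R Z) : expHom hZ hθ x = x :=
  eq_self_of_mem_augPart (φ := (expHom hZ hθ).toLinearMap) hZ (fun r => by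
    rw [AlgHom.toLinearMap_apply, expHom_one_tmul, add_sub_cancel_left]
    exact mem_augPart_of_forall_part hθ.2 r) hx

variable (hZ) in
theorem expHom_comp_expHom_neg (hθ : θ ∈ lowDerivations R Z) :
    (expHom hZ hθ).comp (expHom hZ (neg_mem_lowDerivations hθ)) = AlgHom.id Z (Z ⊗[k] R) := by
  ext r
  have h := mem_augPart_of_forall_part hθ.2 r
  change expHom hZ hθ (expHom hZ (neg_mem_lowDerivations hθ) (1 ⊗ₜ r)) = 1 ⊗ₜ r
  rw [expHom_one_tmul, map_add, expHom_one_tmul, LinearMap.neg_apply,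
    expHom_of_mem_augPart (neg_mem h), add_neg_cancel_right]

variable (hZ) in
/-- The automorphism `exp θ = 1 + θ` of `Z ⊗ R`, for `Z` of square zero. -/
def expEquiv (hθ : θ ∈ lowDerivations R Z) : Z ⊗[k] R ≃ₐ[Z] Z ⊗[k] R :=
  AlgEquiv.ofAlgHom (expHom hZ hθ) (expHom hZ (neg_mem_lowDerivations hθ))
    (expHom_comp_expHom_neg hZ hθ)
    (by simpa only [neg_neg] using expHom_comp_expHom_neg hZ (neg_mem_lowDerivations hθ))

theorem expEquiv_one_tmul (r : R) : expEquiv hZ hθ (1 ⊗ₜ r) = 1 ⊗ₜ r + θ r :=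
  expHom_one_tmul (hZ := hZ) (hθ := hθ) r

variable {E F : Deformation R Z}

theorem commute_D_iff (hZ : Z.IsSquareZero) {φ : Z ⊗[k] R ≃ₐ[Z] Z ⊗[k] R}
    (hφ : ∀ r : R, φ (1 ⊗ₜ r) = 1 ⊗ₜ r + θ r) (hθ : ∀ r, θ r ∈ augPart R Z) :
    (∀ x, φ (E.D x) = F.D (φ x)) ↔ E.e - F.e = coboundary R Z θ := by
  have hφ_aug : ∀ x ∈ augPart R Z, φ x = x := fun x hx =>
    eq_self_of_mem_augPart (φ := φ.toLinearMap) hZ (fun r => by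
      rw [AlgEquiv.toLinearMap_apply, hφ, add_sub_cancel_left]
      exact hθ r) hx
  have hgen : ∀ r : R, φ (E.D (1 ⊗ₜ r)) = F.D (φ (1 ⊗ₜ r)) ↔
      (E.e - F.e) r = coboundary R Z θ r := fun r => by
    rw [D_one_tmul, map_add, hφ, hφ, map_add, D_one_tmul, hφ_aug _ (E.e_mem_augPart r),
      F.D_of_mem_augPart hZ (hθ r), coboundary_apply, LinearMap.sub_apply,
      sub_eq_sub_iff_add_eq_add, add_assoc, add_assoc, add_left_cancel_iff, add_comm (θ _),
      add_comm (F.e r)]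
  have hlin : (∀ x, φ (E.D x) = F.D (φ x)) ↔
      φ.toLinearMap ∘ₗ E.D = F.D ∘ₗ φ.toLinearMap :=
    ⟨fun h => LinearMap.ext h, fun h => LinearMap.congr_fun h⟩
  rw [hlin, LinearMap.ext_iff (f := E.e - F.e)]
  refine ⟨fun h r => (hgen r).1 (LinearMap.congr_fun h _), fun h => ?_⟩
  ext r
  exact (hgen r).2 (h r)

/-- Over a square zero base, the isomorphisms are the `exp θ`, and `exp θ` carries `e` to
`e - [d, θ]`. -/
theorem isIso_iff_exists_lowDerivations (hZ : Z.IsSquareZero) :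
    IsIso E F ↔ ∃ θ ∈ lowDerivations R Z, E.e - F.e = coboundary R Z θ := by
  constructor
  · rintro ⟨φ, hlow, hφ⟩
    let ι : R →ₐ[k] Z ⊗[k] R := Algebra.TensorProduct.includeRight
    let θ : R →ₗ[k] Z ⊗[k] R := φ.toLinearMap.restrictScalars k ∘ₗ ι.toLinearMap - ι.toLinearMap
    have hφθ : ∀ r : R, φ (1 ⊗ₜ r) = 1 ⊗ₜ r + θ r := fun r => (add_sub_cancel _ _).symm
    have hθ := mem_augPart_of_forall_part (θ := θ) (deg := id) hlow
    refine ⟨θ, ⟨mem_derivations_iff.2 fun r s => ?_, hlow⟩, (commute_D_iff hZ hφθ hθ).1 hφ⟩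
    have hmul : φ (1 ⊗ₜ (r * s)) = φ (1 ⊗ₜ r) * φ (1 ⊗ₜ s) := by
      rw [← map_mul, Algebra.TensorProduct.tmul_mul_tmul, mul_one]
    rw [hφθ, hφθ, hφθ, add_mul, mul_add, mul_add, mul_eq_zero_of_mem_augPart hZ (hθ r) (hθ s),
      Algebra.TensorProduct.tmul_mul_tmul, mul_one, add_assoc, add_left_cancel_iff, add_zero]
      at hmul
    rw [hmul, add_comm]
  · rintro ⟨θ, hθ, h⟩
    refine ⟨expEquiv hZ hθ, fun n w r hr => ?_, (commute_D_iff hZ expEquiv_one_tmul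
      (mem_augPart_of_forall_part hθ.2)).2 h⟩
    rw [expEquiv_one_tmul, add_sub_cancel_left]
    exact hθ.2 n w r hr

end Deformation

/-! ### The Kodaira-Spencer map -/

theorem WeightedAlgebra.eventually_sum_proj_eq {z : Z} (hz : z ∈ Z.maxIdeal) :
    ∀ᶠ N in Filter.atTop, ∑ i ∈ Finset.range N, Z.proj (i + 1) z = z := by
  induction hz using maxIdeal_induction with
  | zero => simp only [map_zero, Finset.sum_const_zero, Filter.eventually_true]
  | add x y _ _ hx hy =>
    filter_upwards [hx, hy] with N hxN hyN
    simp only [map_add, Finset.sum_add_distrib, hxN, hyN]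
  | mem n hn z hz =>
    filter_upwards [Filter.eventually_ge_atTop n] with N hN
    rw [Finset.sum_eq_single_of_mem (n - 1) (Finset.mem_range.2 (by omega)) fun i _ hi =>
      proj_of_mem_of_ne hz (by omega), Nat.sub_add_cancel hn, proj_of_mem hz]

/-- The component of weight `i`, as a linear map to `Zᵢ`. -/
def WeightedAlgebra.toPart (Z : WeightedAlgebra k) (i : ℕ) : Z →ₗ[k] Z.part i :=
  (Z.proj i).codRestrict (Z.part i) (proj_mem i)

theorem exists_forall_eventually_eq_sum {V W : Type*} [AddCommGroup V] [Module k V]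
    [AddCommGroup W] [Module k W] {η : ℕ → V →ₗ[k] W}
    (hη : ∀ v, ∀ᶠ i in Filter.atTop, η i v = 0) :
    ∃ Θ : V →ₗ[k] W, ∀ v, ∀ᶠ N in Filter.atTop, Θ v = ∑ i ∈ Finset.range N, η i v := by
  have hsupp : ∀ v, ∃ N₀, ∀ N ≥ N₀,
      (Function.support fun i => η i v) ⊆ Finset.range N := fun v => by
    obtain ⟨N₀, hN₀⟩ := Filter.eventually_atTop.1 (hη v)
    refine ⟨N₀, fun N hN i hi => Finset.mem_coe.2 (Finset.mem_range.2 ?_)⟩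
    by_contra! hiN
    exact hi (hN₀ i (hN.trans hiN))
  have hfin : ∀ v, (Function.support fun i => η i v).Finite := fun v =>
    let ⟨N₀, hN₀⟩ := hsupp v
    (Finset.finite_toSet _).subset (hN₀ N₀ le_rfl)
  refine ⟨⟨⟨fun v => ∑ᶠ i, η i v, fun v w => ?_⟩, fun c v => ?_⟩, fun v => ?_⟩
  · simp only [map_add]
    exact finsum_add_distrib (hfin v) (hfin w)
  · simp only [map_smul, RingHom.id_apply]
    exact (smul_finsum' c (hfin v)).symm
  · obtain ⟨N₀, hN₀⟩ := hsupp v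
    filter_upwards [Filter.eventually_ge_atTop N₀] with N hN
    exact finsum_eq_sum_of_support_subset _ (hN₀ N hN)

section

variable {Y Y' : Type*} [AddCommGroup Y] [Module k Y] [AddCommGroup Y'] [Module k Y']

/-- The tensors in `Y ⊗ R` of total degree `n` and of total weight `w`, where `Y` has weight `i`. -/
def shiftPart (R : WeightedDGCA.{u, v} k) (Y : Type*) [AddCommGroup Y] [Module k Y] (i n w : ℕ) :
    Submodule k (Y ⊗[k] R) :=
  Submodule.span k {x | ∃ j, i + j = w ∧ ∃ y : Y, ∃ r ∈ R.part (n, j), x = y ⊗ₜ[k] r}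

theorem shiftPart_le {i n w : ℕ} {P : Submodule k (Y ⊗[k] R)}
    (h : ∀ j, i + j = w → ∀ (y : Y), ∀ r ∈ R.part (n, j), y ⊗ₜ[k] r ∈ P) :
    shiftPart R Y i n w ≤ P := by
  refine Submodule.span_le.2 ?_
  rintro _ ⟨j, hj, y, r, hr, rfl⟩
  exact h j hj y r hr

theorem tmul_mem_shiftPart {i j n w : ℕ} (hj : i + j = w) (y : Y) {r : R}
    (hr : r ∈ R.part (n, j)) : y ⊗ₜ[k] r ∈ shiftPart R Y i n w :=
  Submodule.subset_span ⟨j, hj, y, r, hr, rfl⟩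

theorem shiftPart_eq_bot {i n w : ℕ} (hw : w < i) : shiftPart R Y i n w = ⊥ :=
  eq_bot_iff.2 (shiftPart_le fun j hj => absurd hj (by omega))

theorem rTensor_mem_shiftPart (g : Y →ₗ[k] Y') {i n w : ℕ} {x : Y ⊗[k] R}
    (hx : x ∈ shiftPart R Y i n w) : g.rTensor R x ∈ shiftPart R Y' i n w :=
  shiftPart_le (P := (shiftPart R Y' i n w).comap (g.rTensor R))
    (fun _ hj y _ hr => tmul_mem_shiftPart hj (g y) hr) hx

theorem rTensor_toPart_mem_shiftPart {i n w : ℕ} {x : Z ⊗[k] R} (hx : x ∈ lowPart R Z n w) :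
    (Z.toPart i).rTensor R x ∈ shiftPart R (Z.part i) i n w := by
  have hle : lowPart R Z n w ≤
      (shiftPart R (Z.part i) i n w).comap ((Z.toPart i).rTensor R) := by
    refine Submodule.span_le.2 ?_
    rintro _ ⟨i', j, -, hij, z, hz, r, hr, rfl⟩
    rw [SetLike.mem_coe, Submodule.mem_comap, LinearMap.rTensor_tmul]
    by_cases h : i' = i
    · exact tmul_mem_shiftPart (h ▸ hij) _ hr
    · have hz₀ : Z.toPart i z = 0 := Subtype.ext (proj_of_mem_of_ne hz h)
      rw [hz₀, TensorProduct.zero_tmul]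
      exact zero_mem _
  exact hle hx

theorem rTensor_subtype_mem_lowPart {i n w : ℕ} (hi : 0 < i) {x : Z.part i ⊗[k] R}
    (hx : x ∈ shiftPart R (Z.part i) i n w) :
    (Z.part i).subtype.rTensor R x ∈ lowPart R Z n w :=
  shiftPart_le (P := (lowPart R Z n w).comap ((Z.part i).subtype.rTensor R))
    (fun j hj y r hr => Submodule.subset_span ⟨i, j, hi, hj, y, y.2, r, hr, rfl⟩) hx

variable (R Y) in
/-- The derivations of `R` with values in `Y ⊗ R`, where `Y` has weight `i`, that preserve the
total degree and the total weight. -/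
def shiftDerivations (i : ℕ) : Submodule k (R →ₗ[k] Y ⊗[k] R) where
  carrier := {θ | θ ∈ derivations R Y ∧
    ∀ n w, ∀ r ∈ R.part (n, w), θ r ∈ shiftPart R Y i n w}
  zero_mem' := ⟨zero_mem _, fun _ _ _ _ => zero_mem _⟩
  add_mem' hθ hη := ⟨add_mem hθ.1 hη.1, fun n w r hr => add_mem (hθ.2 n w r hr) (hη.2 n w r hr)⟩
  smul_mem' c _ hθ := ⟨Submodule.smul_mem _ c hθ.1,
    fun n w r hr => Submodule.smul_mem _ c (hθ.2 n w r hr)⟩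

theorem rTensor_lTensor_comm (g : Y →ₗ[k] Y') (h : R →ₗ[k] R) (x : Y ⊗[k] R) :
    g.rTensor R (h.lTensor Y x) = h.lTensor Y' (g.rTensor R x) := by
  rw [← LinearMap.comp_apply, ← LinearMap.comp_apply, LinearMap.rTensor_comp_lTensor,
    LinearMap.lTensor_comp_rTensor]

theorem rTensor_comp_mem_derivations (g : Y →ₗ[k] Y') {θ : R →ₗ[k] Y ⊗[k] R}
    (hθ : θ ∈ derivations R Y) : g.rTensor R ∘ₗ θ ∈ derivations R Y' := fun r s => by
  simp only [LinearMap.comp_apply, hθ r s, map_add, rTensor_lTensor_comm]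

theorem rTensor_comp_mem_shiftDerivations (g : Y →ₗ[k] Y') {i : ℕ} {θ : R →ₗ[k] Y ⊗[k] R}
    (hθ : θ ∈ shiftDerivations R Y i) : g.rTensor R ∘ₗ θ ∈ shiftDerivations R Y' i :=
  ⟨rTensor_comp_mem_derivations g hθ.1, fun n w r hr => rTensor_mem_shiftPart g (hθ.2 n w r hr)⟩

theorem coboundary_rTensor_comp (g : Y →ₗ[k] Y') (θ : R →ₗ[k] Y ⊗[k] R) :
    coboundary R Y' (g.rTensor R ∘ₗ θ) = g.rTensor R ∘ₗ coboundary R Y θ := by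
  ext r
  simp only [coboundary_apply, LinearMap.comp_apply, map_sub, rTensor_lTensor_comm]

end

namespace Deformation

theorem eventually_sum_rTensor_proj_eq {x : Z ⊗[k] R} (hx : x ∈ augPart R Z) :
    ∀ᶠ N in Filter.atTop, ∑ i ∈ Finset.range N, (Z.proj (i + 1)).rTensor R x = x := by
  have hadd : ∀ x y : Z ⊗[k] R,
      (∀ᶠ N in Filter.atTop, ∑ i ∈ Finset.range N, (Z.proj (i + 1)).rTensor R x = x) →
      (∀ᶠ N in Filter.atTop, ∑ i ∈ Finset.range N, (Z.proj (i + 1)).rTensor R y = y) →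
      ∀ᶠ N in Filter.atTop, ∑ i ∈ Finset.range N, (Z.proj (i + 1)).rTensor R (x + y) = x + y := by
    intro x y hx hy
    filter_upwards [hx, hy] with N hxN hyN
    simp only [map_add, Finset.sum_add_distrib, hxN, hyN]
  induction hx using Submodule.smul_induction_on' with
  | add x _ y _ hx hy => exact hadd x y hx hy
  | smul z hz x hx =>
    clear hx
    induction x using TensorProduct.induction_on with
    | zero => simp only [smul_zero, map_zero, Finset.sum_const_zero, Filter.eventually_true]
    | add x y hx hy => exact smul_add z x y ▸ hadd _ _ hx hy
    | tmul z' r =>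
      rw [TensorProduct.smul_tmul']
      filter_upwards [eventually_sum_proj_eq (Z.maxIdeal.mul_mem_right z' hz)] with N hN
      simp only [LinearMap.rTensor_tmul, ← TensorProduct.sum_tmul, smul_eq_mul, hN]

theorem isIso_of_forall_mem_coboundary (hZ : Z.IsSquareZero) {E F : Deformation R Z}
    (h : ∀ i, 0 < i → (Z.toPart i).rTensor R ∘ₗ (E.e - F.e) ∈
      (shiftDerivations R (Z.part i) i).map (coboundary R (Z.part i))) : IsIso E F := by
  choose θ hθ hθd using fun i => Submodule.mem_map.1 (h (i + 1) i.succ_pos)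
  let η : ℕ → R →ₗ[k] Z ⊗[k] R := fun i => (Z.part (i + 1)).subtype.rTensor R ∘ₗ θ i
  have hη : ∀ i, η i ∈ derivations R Z := fun i => rTensor_comp_mem_derivations _ (hθ i).1
  have hηd : ∀ i, coboundary R Z (η i) = (Z.proj (i + 1)).rTensor R ∘ₗ (E.e - F.e) := fun i => by
    rw [coboundary_rTensor_comp, hθd, ← LinearMap.comp_assoc, ← LinearMap.rTensor_comp]
    rfl
  have hη_zero : ∀ r, ∀ᶠ i in Filter.atTop, η i r = 0 := fun r => by
    induction r using WeightedDGCA.part_induction with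
    | zero => simp only [map_zero, Filter.eventually_true]
    | add r s hr hs =>
      filter_upwards [hr, hs] with i hri hsi
      rw [map_add, hri, hsi, add_zero]
    | mem n w r hr =>
      filter_upwards [Filter.eventually_ge_atTop w] with i hi
      have hθr := (hθ i).2 n w r hr
      rw [shiftPart_eq_bot (by omega), Submodule.mem_bot] at hθr
      rw [LinearMap.comp_apply, hθr, map_zero]
  obtain ⟨Θ, hΘ⟩ := exists_forall_eventually_eq_sum hη_zero
  refine (isIso_iff_exists_lowDerivations hZ).2 ⟨Θ, ⟨mem_derivations_iff.2 fun r s => ?_,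
    fun n w r hr => ?_⟩, LinearMap.ext fun r => ?_⟩
  · obtain ⟨N, hrs, hr, hs⟩ := ((hΘ (r * s)).and ((hΘ r).and (hΘ s))).exists
    rw [hrs, hr, hs, Finset.sum_mul, Finset.mul_sum, ← Finset.sum_add_distrib]
    exact Finset.sum_congr rfl fun i _ => mem_derivations_iff.1 (hη i) r s
  · obtain ⟨N, hN⟩ := (hΘ r).exists
    rw [hN]
    exact sum_mem fun i _ => rTensor_subtype_mem_lowPart i.succ_pos ((hθ i).2 n w r hr)
  · obtain ⟨N, hr, hdr, hN⟩ := ((hΘ r).and ((hΘ (R.d r)).and (eventually_sum_rTensor_proj_eq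
      (sub_mem (E.e_mem_augPart r) (F.e_mem_augPart r))))).exists
    rw [coboundary_apply, hr, hdr, map_sum, ← Finset.sum_sub_distrib, LinearMap.sub_apply, ← hN]
    exact Finset.sum_congr rfl fun i _ => (LinearMap.congr_fun (hηd i) r).symm

theorem isIso_iff_forall_mem_coboundary (hZ : Z.IsSquareZero) {E F : Deformation R Z} :
    IsIso E F ↔ ∀ i, 0 < i → (Z.toPart i).rTensor R ∘ₗ (E.e - F.e) ∈
      (shiftDerivations R (Z.part i) i).map (coboundary R (Z.part i)) := by
  refine ⟨fun h i _ => ?_, isIso_of_forall_mem_coboundary hZ⟩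
  obtain ⟨θ, hθ, hθd⟩ := (isIso_iff_exists_lowDerivations hZ).1 h
  refine ⟨(Z.toPart i).rTensor R ∘ₗ θ, ⟨rTensor_comp_mem_derivations _ hθ.1,
    fun n w r hr => rTensor_toPart_mem_shiftPart (hθ.2 n w r hr)⟩, ?_⟩
  rw [coboundary_rTensor_comp, hθd]

section

variable (E : Deformation R A) (i : ℕ) (Y : Type*) [AddCommGroup Y] [Module k Y]

/-- The Kodaira-Spencer map of a family on tangent vectors with values in `Y`: it sends `μ : A → Y`
to the infinitesimal deformation `(μ ⊗ 1) ∘ e`. -/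
def kodairaSpencer : (A →ₗ[k] Y) →ₗ[k] R →ₗ[k] Y ⊗[k] R :=
  LinearMap.lcomp k (Y ⊗[k] R) E.e ∘ₗ LinearMap.rTensorHom R

/-- The linear maps `A → Y`, `Y` of weight `i`, whose image under the Kodaira-Spencer map is a
trivial infinitesimal deformation. -/
def exactMaps : Submodule k (A →ₗ[k] Y) :=
  ((shiftDerivations R Y i).map (coboundary R Y)).comap (E.kodairaSpencer Y)

end

variable {E : Deformation R A} {i : ℕ}

theorem comp_mem_exactMaps {Y Y' : Type*} [AddCommGroup Y] [Module k Y] [AddCommGroup Y']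
    [Module k Y'] (g : Y →ₗ[k] Y') {μ : A →ₗ[k] Y} (hμ : μ ∈ E.exactMaps i Y) :
    g ∘ₗ μ ∈ E.exactMaps i Y' := by
  obtain ⟨θ, hθ, hθμ⟩ := hμ
  refine ⟨g.rTensor R ∘ₗ θ, rTensor_comp_mem_shiftDerivations g hθ, ?_⟩
  rw [coboundary_rTensor_comp, hθμ]
  exact LinearMap.ext fun r => (LinearMap.rTensor_comp_apply R g μ (E.e r)).symm

theorem isIso_map_iff (hZ : Z.IsSquareZero) {f g : WHom A Z} :
    IsIso (E.map f) (E.map g) ↔ ∀ i, 0 < i →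
      Z.toPart i ∘ₗ (f.toAlgHom.toLinearMap - g.toAlgHom.toLinearMap) ∈
        E.exactMaps i (Z.part i) := by
  have hsub : (E.map f).e - (E.map g).e =
      E.kodairaSpencer Z (f.toAlgHom.toLinearMap - g.toAlgHom.toLinearMap) :=
    (map_sub (E.kodairaSpencer Z) f.toAlgHom.toLinearMap g.toAlgHom.toLinearMap).symm
  have hcomp : ∀ i, (Z.toPart i).rTensor R ∘ₗ ((E.map f).e - (E.map g).e) =
      E.kodairaSpencer (Z.part i)
        (Z.toPart i ∘ₗ (f.toAlgHom.toLinearMap - g.toAlgHom.toLinearMap)) := fun i => by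
    rw [hsub]
    exact LinearMap.ext fun r => (LinearMap.rTensor_comp_apply R _ _ (E.e r)).symm
  simp only [isIso_iff_forall_mem_coboundary hZ, hcomp]
  rfl

end Deformation

/-! ### Contractions -/

section

variable {V Y Y' : Type*} [AddCommGroup V] [Module k V] [AddCommGroup Y] [Module k Y]
  [AddCommGroup Y'] [Module k Y']

variable (k V Y) in
/-- Contraction of `Y ⊗ V` with linear forms on `V`. -/
def contract : Y ⊗[k] V →ₗ[k] Module.Dual k V →ₗ[k] Y :=
  dualTensorHom k (Module.Dual k V) Y ∘ₗ (Module.Dual.eval k V).rTensor Y ∘ₗ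
    (TensorProduct.comm k Y V).toLinearMap

@[simp]
theorem contract_tmul (y : Y) (v : V) (f : Module.Dual k V) :
    contract k V Y (y ⊗ₜ v) f = f v • y := rfl

theorem contract_lTensor (g : V →ₗ[k] V) (x : Y ⊗[k] V) (f : Module.Dual k V) :
    contract k V Y (g.lTensor Y x) f = contract k V Y x (f ∘ₗ g) := by
  induction x using TensorProduct.induction_on with
  | zero => simp only [map_zero, LinearMap.zero_apply]
  | add x y hx hy => simp only [map_add, LinearMap.add_apply, hx, hy]
  | tmul y v => rfl

theorem contract_rTensor (g : Y →ₗ[k] Y') (x : Y ⊗[k] V) (f : Module.Dual k V) :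
    contract k V Y' (g.rTensor V x) f = g (contract k V Y x f) := by
  induction x using TensorProduct.induction_on with
  | zero => simp only [map_zero, LinearMap.zero_apply]
  | add x y hx hy => simp only [map_add, LinearMap.add_apply, hx, hy]
  | tmul y v => exact (map_smul g (f v) y).symm

theorem contract_injective : Function.Injective (contract k V Y) := by
  classical
  let b := Module.Basis.ofVectorSpace k V
  have hcoord : ∀ (x : Y ⊗[k] V) i,
      TensorProduct.equivFinsuppOfBasisRight b x i = contract k V Y x (b.coord i) := fun x i => by
    induction x using TensorProduct.induction_on with
    | zero => simp only [map_zero, Finsupp.zero_apply, LinearMap.zero_apply]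
    | add x y hx hy => simp only [map_add, LinearMap.add_apply, Finsupp.add_apply, hx, hy]
    | tmul y v => simp
  intro x y hxy
  apply (TensorProduct.equivFinsuppOfBasisRight (M := Y) b).injective
  ext i
  rw [hcoord, hcoord, hxy]

theorem exists_contract_lTensor_subtype_eq {U : Submodule k V} [Module.Finite k U]
    {T : Module.Dual k V →ₗ[k] Y} (hT : U.dualAnnihilator ≤ LinearMap.ker T) :
    ∃ x : Y ⊗[k] U, contract k V Y (U.subtype.lTensor Y x) = T := by
  obtain ⟨π, hπ⟩ := LinearMap.exists_leftInverse_of_injective U.subtype U.ker_subtype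
  let b := Module.finBasis k U
  refine ⟨∑ i, T (b.coord i ∘ₗ π) ⊗ₜ b i, LinearMap.ext fun f => ?_⟩
  have hf : f - (f ∘ₗ U.subtype) ∘ₗ π ∈ U.dualAnnihilator := by
    refine (Submodule.mem_dualAnnihilator _).2 fun a ha => ?_
    have hπa : π a = ⟨a, ha⟩ := LinearMap.congr_fun hπ ⟨a, ha⟩
    simp [hπa]
  have hTf : T f = T ((f ∘ₗ U.subtype) ∘ₗ π) := by
    rw [← sub_eq_zero, ← map_sub]
    exact hT hf
  calc contract k V Y (U.subtype.lTensor Y (∑ i, T (b.coord i ∘ₗ π) ⊗ₜ b i)) f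
      = ∑ i, f (b i) • T (b.coord i ∘ₗ π) := by
        simp only [map_sum, LinearMap.sum_apply, LinearMap.lTensor_tmul, contract_tmul,
          Submodule.subtype_apply]
    _ = (T ∘ₗ π.dualMap) (∑ i, (f ∘ₗ U.subtype) (b i) • b.coord i) := by
        simp only [map_sum, map_smul]; rfl
    _ = T f := by rw [b.sum_dual_apply_smul_coord, hTf]; rfl

end

theorem exists_comp_eq_of_ker_le {V W Y : Type*} [AddCommGroup V] [Module k V] [AddCommGroup W]
    [Module k W] [AddCommGroup Y] [Module k Y] {j : V →ₗ[k] W} {μ : V →ₗ[k] Y}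
    (h : LinearMap.ker j ≤ LinearMap.ker μ) : ∃ Φ : W →ₗ[k] Y, Φ ∘ₗ j = μ := by
  obtain ⟨Φ, hΦ⟩ := LinearMap.exists_extend
    ((LinearMap.ker j).liftQ μ h ∘ₗ j.quotKerEquivRange.symm.toLinearMap)
  refine ⟨Φ, LinearMap.ext fun v => ?_⟩
  have hv := LinearMap.congr_fun hΦ (j.quotKerEquivRange ((LinearMap.ker j).mkQ v))
  rwa [LinearMap.comp_apply, LinearMap.comp_apply, LinearEquiv.coe_coe,
    LinearEquiv.symm_apply_apply] at hv

/-- Elimination: `G` is read as a system of linear equations in the unknown `T` with data `μ`. -/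
theorem exists_le_ker_coprod_iff {V W Y : Type*} [AddCommGroup V] [Module k V] [AddCommGroup W]
    [Module k W] [AddCommGroup Y] [Module k Y] {G : Submodule k (V × W)} {μ : W →ₗ[k] Y} :
    (∃ T : V →ₗ[k] Y, G ≤ LinearMap.ker (T.coprod μ)) ↔
      G.comap (LinearMap.inr k V W) ≤ LinearMap.ker μ := by
  constructor
  · rintro ⟨T, hT⟩ a ha
    simpa using hT ha
  · intro hμ
    obtain ⟨Φ, hΦ⟩ := exists_comp_eq_of_ker_le (j := G.mkQ ∘ₗ LinearMap.inr k V W) (μ := μ) (by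
      rwa [LinearMap.ker_comp, Submodule.ker_mkQ])
    refine ⟨Φ ∘ₗ G.mkQ ∘ₗ LinearMap.inl k V W, ?_⟩
    have hcoprod : (Φ ∘ₗ G.mkQ ∘ₗ LinearMap.inl k V W).coprod μ = Φ ∘ₗ G.mkQ :=
      LinearMap.prod_ext (LinearMap.coprod_inl _ _) ((LinearMap.coprod_inr _ _).trans hΦ.symm)
    rw [hcoprod]
    exact G.ker_mkQ.ge.trans (LinearMap.ker_le_ker_comp _ _)

/-! ### Exactness kernels -/

variable (A) in
/-- The kernel of the projection from `A` to the component of weight `i` of `m_A / m_A²`. -/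
def WeightedAlgebra.cotangentKer (i : ℕ) : Submodule k A :=
  LinearMap.ker (A.proj i) ⊔ (A.maxIdeal ^ 2).restrictScalars k

/-- A subspace `N` of `A` through which precisely those tangent vectors of weight `i` factor whose
image under the Kodaira-Spencer map is trivial, for tangent vectors with values in any space. -/
def Deformation.IsExactnessKernel (E : Deformation R A) (i : ℕ) (N : Submodule k A) : Prop :=
  ∀ (Y : Type u) [AddCommGroup Y] [Module k Y] (μ : A →ₗ[k] Y),
    N ≤ LinearMap.ker μ ↔ μ ∈ E.exactMaps i Y ∧ A.cotangentKer i ≤ LinearMap.ker μ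

namespace Deformation

variable (E : Deformation R A) (i : ℕ)

/-- The linear forms on the component of weight `i` of `m_A / m_A²` that the Kodaira-Spencer map
sends to trivial infinitesimal deformations. -/
def exactForms : Submodule k (Module.Dual k A) :=
  E.exactMaps i k ⊓ (A.cotangentKer i).dualAnnihilator

theorem finite_exactForms [Module.Finite k (A.part i)] : Module.Finite k (E.exactForms i) := by
  refine Module.Finite.of_injective ((A.part i).subtype.dualMap ∘ₗ (E.exactForms i).subtype)
    ((injective_iff_map_eq_zero _).2 ?_)
  rintro ⟨τ, hτ⟩ hτ₀
  refine Subtype.ext (LinearMap.ext fun a => ?_)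
  have hproj : a - A.proj i a ∈ A.cotangentKer i := Submodule.mem_sup_left (by
    rw [LinearMap.mem_ker, map_sub, proj_of_mem (proj_mem i a), sub_self])
  have hτa : τ (a - A.proj i a) = 0 := (Submodule.mem_dualAnnihilator τ).1 hτ.2 _ hproj
  rw [map_sub, sub_eq_zero] at hτa
  exact hτa.trans (LinearMap.congr_fun hτ₀ ⟨A.proj i a, proj_mem i a⟩)

theorem isExactnessKernel_dualCoannihilator [Module.Finite k (A.part i)] :
    E.IsExactnessKernel i (E.exactForms i).dualCoannihilator := by
  have := E.finite_exactForms i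
  intro Y _ _ μ
  constructor
  · intro hμ
    let N := (E.exactForms i).dualCoannihilator
    have : FiniteDimensional k (A ⧸ N) :=
      Subspace.finiteDimensional_quot_dualCoannihilator_iff.2 inferInstance
    let b := Module.finBasis k (A ⧸ N)
    have hb : ∀ j, b.coord j ∘ₗ N.mkQ ∈ E.exactForms i := fun j => by
      rw [← Subspace.dualCoannihilator_dualAnnihilator_eq (W := E.exactForms i),
        Submodule.mem_dualAnnihilator]
      intro a ha
      rw [LinearMap.comp_apply, Submodule.mkQ_apply, (Submodule.Quotient.mk_eq_zero N).2 ha,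
        map_zero]
    have hsum : μ = ∑ j, LinearMap.toSpanSingleton k Y (N.liftQ μ hμ (b j)) ∘ₗ
        (b.coord j ∘ₗ N.mkQ) := LinearMap.ext fun a => by
      have ha := congrArg (N.liftQ μ hμ) (b.sum_repr (N.mkQ a))
      rw [map_sum] at ha
      simpa using ha.symm
    refine ⟨?_, fun a ha => hμ ((Submodule.mem_dualCoannihilator a).2 fun τ hτ =>
      (Submodule.mem_dualAnnihilator τ).1 hτ.2 a ha)⟩
    rw [hsum]
    exact sum_mem fun j _ => comp_mem_exactMaps _ (hb j).1
  · rintro ⟨hμ, hker⟩ a ha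
    refine (Module.forall_dual_apply_eq_zero_iff k (μ a)).1 fun f => ?_
    refine (Submodule.mem_dualCoannihilator a).1 ha (f ∘ₗ μ) ⟨comp_mem_exactMaps f hμ, ?_⟩
    refine (Submodule.mem_dualAnnihilator _).2 fun c hc => ?_
    rw [LinearMap.comp_apply, hker hc, map_zero]

section

variable {Y : Type*} [AddCommGroup Y] [Module k Y]

variable (R Y) in
/-- A linear map `θ : R → Y ⊗ R` viewed as the linear map `r ⊗ f ↦ (1 ⊗ f) (θ r)`. -/
def pairing : (R →ₗ[k] Y ⊗[k] R) →ₗ[k] R ⊗[k] Module.Dual k R →ₗ[k] Y :=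
  (TensorProduct.lift.equiv (RingHom.id k) R (Module.Dual k R) Y).toLinearMap ∘ₗ
    LinearMap.llcomp k R (Y ⊗[k] R) (Module.Dual k R →ₗ[k] Y) (contract k R Y)

@[simp]
theorem pairing_tmul (θ : R →ₗ[k] Y ⊗[k] R) (r : R) (f : Module.Dual k R) :
    pairing R Y θ (r ⊗ₜ f) = contract k R Y (θ r) f := rfl

theorem pairing_injective : Function.Injective (pairing R Y) := fun _ _ h =>
  LinearMap.ext fun r => contract_injective (LinearMap.ext fun f =>
    LinearMap.congr_fun h (r ⊗ₜ f))

variable (R) in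
/-- The tensors that `pairing` kills for the maps `θ : R → Y ⊗ R` of total degree and total weight
zero, where `Y` has weight `i`. -/
def degreeRelations : Submodule k (R ⊗[k] Module.Dual k R) :=
  Submodule.span k {x | ∃ n w, ∃ r ∈ R.part (n, w), ∃ f : Module.Dual k R,
    (∀ j, i + j = w → R.part (n, j) ≤ LinearMap.ker f) ∧ x = r ⊗ₜ f}

variable (R) in
/-- The tensors that `pairing` kills for derivations. -/
def leibnizRelations : Submodule k (R ⊗[k] Module.Dual k R) :=
  Submodule.span k {x | ∃ (r s : R) (f : Module.Dual k R), x = (r * s) ⊗ₜ f -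
    (r ⊗ₜ (f ∘ₗ LinearMap.mulRight k s) + s ⊗ₜ (f ∘ₗ LinearMap.mulLeft k r))}

variable (R) in
/-- The transpose of `coboundary` with respect to `pairing`. -/
def boundary : R ⊗[k] Module.Dual k R →ₗ[k] R ⊗[k] Module.Dual k R :=
  R.d.dualMap.lTensor R - R.d.rTensor (Module.Dual k R)

theorem pairing_coboundary (θ : R →ₗ[k] Y ⊗[k] R) :
    pairing R Y (coboundary R Y θ) = pairing R Y θ ∘ₗ boundary R :=
  TensorProduct.ext' fun r f => by
    rw [pairing_tmul, coboundary_apply, map_sub, LinearMap.sub_apply, contract_lTensor]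
    simp only [boundary, LinearMap.comp_apply, LinearMap.sub_apply, map_sub,
      LinearMap.lTensor_tmul, LinearMap.rTensor_tmul, pairing_tmul, LinearMap.dualMap_apply']

theorem pairing_kodairaSpencer (μ : A →ₗ[k] Y) :
    pairing R Y (E.kodairaSpencer Y μ) = μ ∘ₗ pairing R A E.e :=
  TensorProduct.ext' fun r f => contract_rTensor μ (E.e r) f

theorem leibnizRelations_le_ker_pairing_iff {θ : R →ₗ[k] Y ⊗[k] R} :
    leibnizRelations R ≤ LinearMap.ker (pairing R Y θ) ↔ θ ∈ derivations R Y := by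
  have hgen : ∀ (r s : R) (f : Module.Dual k R),
      pairing R Y θ ((r * s) ⊗ₜ f - (r ⊗ₜ (f ∘ₗ LinearMap.mulRight k s) +
        s ⊗ₜ (f ∘ₗ LinearMap.mulLeft k r))) =
      contract k R Y (θ (r * s)) f - contract k R Y ((LinearMap.mulRight k s).lTensor Y (θ r) +
        (LinearMap.mulLeft k r).lTensor Y (θ s)) f := fun r s f => by
    simp only [map_sub, map_add, pairing_tmul, LinearMap.add_apply, contract_lTensor]
  constructor
  · intro h r s
    refine contract_injective (LinearMap.ext fun f => sub_eq_zero.1 ?_)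
    exact (hgen r s f).symm.trans (h (Submodule.subset_span ⟨r, s, f, rfl⟩))
  · intro h
    refine Submodule.span_le.2 ?_
    rintro _ ⟨r, s, f, rfl⟩
    exact (hgen r s f).trans (by rw [h r s, sub_self])

variable {i}

theorem degreeRelations_le_ker_pairing {θ : R →ₗ[k] Y ⊗[k] R}
    (hθ : ∀ n w, ∀ r ∈ R.part (n, w), θ r ∈ shiftPart R Y i n w) :
    degreeRelations R i ≤ LinearMap.ker (pairing R Y θ) := by
  refine Submodule.span_le.2 ?_
  rintro _ ⟨n, w, r, hr, f, hf, rfl⟩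
  have hle : shiftPart R Y i n w ≤ LinearMap.ker ((contract k R Y).flip f) :=
    shiftPart_le fun j hj y s hs => by
      have hfs : f s = 0 := hf j hj hs
      rw [LinearMap.mem_ker, LinearMap.flip_apply, contract_tmul, hfs, zero_smul]
  exact hle (hθ n w r hr)

theorem exists_mem_shiftPart_contract_eq (hR : R.IsFiniteType) {n w : ℕ}
    {T : Module.Dual k R →ₗ[k] Y}
    (hT : ∀ f : Module.Dual k R, (∀ j, i + j = w → R.part (n, j) ≤ LinearMap.ker f) → T f = 0) :
    ∃ x ∈ shiftPart R Y i n w, contract k R Y x = T := by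
  by_cases h : ∃ j, i + j = w
  · obtain ⟨j, hj⟩ := h
    have := hR (n, j)
    obtain ⟨x, hx⟩ := exists_contract_lTensor_subtype_eq (U := R.part (n, j)) (T := T)
      fun f hf => hT f fun j' hj' => by
        obtain rfl : j' = j := by omega
        exact (Submodule.mem_dualAnnihilator f).1 hf
    refine ⟨_, ?_, hx⟩
    clear hx
    induction x using TensorProduct.induction_on with
    | zero => simp only [map_zero, zero_mem]
    | add x y hx hy => simpa only [map_add] using add_mem hx hy
    | tmul y r => exact tmul_mem_shiftPart hj y r.2
  · refine ⟨0, zero_mem _, LinearMap.ext fun f => ?_⟩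
    rw [hT f fun j hj => absurd ⟨j, hj⟩ h, map_zero, LinearMap.zero_apply]

theorem exists_pairing_eq (hR : R.IsFiniteType) {T : R ⊗[k] Module.Dual k R →ₗ[k] Y}
    (hT : degreeRelations R i ≤ LinearMap.ker T) :
    ∃ θ : R →ₗ[k] Y ⊗[k] R, (∀ n w, ∀ r ∈ R.part (n, w), θ r ∈ shiftPart R Y i n w) ∧
      pairing R Y θ = T := by
  have hpart : ∀ n w, ∀ r ∈ R.part (n, w), ∃ x ∈ shiftPart R Y i n w,
      contract k R Y x = TensorProduct.curry T r := fun n w r hr =>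
    exists_mem_shiftPart_contract_eq hR fun f hf =>
      hT (Submodule.subset_span ⟨n, w, r, hr, f, hf, rfl⟩)
  have hrange : ∀ r, TensorProduct.curry T r ∈ LinearMap.range (contract k R Y) := fun r => by
    induction r using WeightedDGCA.part_induction with
    | zero => simp only [map_zero, zero_mem]
    | add r s hr hs => simpa only [map_add] using add_mem hr hs
    | mem n w r hr => exact (hpart n w r hr).imp fun x hx => hx.2
  let contractEquiv := LinearEquiv.ofInjective (contract k R Y) contract_injective
  let θ : R →ₗ[k] Y ⊗[k] R :=
    contractEquiv.symm.toLinearMap ∘ₗ (TensorProduct.curry T).codRestrict _ hrange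
  have hθ : ∀ r, contract k R Y (θ r) = TensorProduct.curry T r := fun r =>
    congrArg Subtype.val (contractEquiv.apply_symm_apply ⟨_, hrange r⟩)
  refine ⟨θ, fun n w r hr => ?_, TensorProduct.ext' fun r f => LinearMap.congr_fun (hθ r) f⟩
  obtain ⟨x, hx, hxr⟩ := hpart n w r hr
  rwa [contract_injective ((hθ r).trans hxr.symm)]

end

/-- The linear equations, in the unknown `pairing θ`, that express that the derivation `θ` has
coboundary `(μ ⊗ 1) ∘ e`. -/
def exactnessRelations : Submodule k ((R ⊗[k] Module.Dual k R) × A) :=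
  (degreeRelations R i ⊔ leibnizRelations R).prod (A.cotangentKer i) ⊔
    LinearMap.range ((boundary R).prod (-pairing R A E.e))

theorem exactnessRelations_le_ker_coprod_iff {Y : Type*} [AddCommGroup Y] [Module k Y]
    {T : R ⊗[k] Module.Dual k R →ₗ[k] Y} {μ : A →ₗ[k] Y} :
    E.exactnessRelations i ≤ LinearMap.ker (T.coprod μ) ↔
      ((degreeRelations R i ≤ LinearMap.ker T ∧ leibnizRelations R ≤ LinearMap.ker T) ∧
        A.cotangentKer i ≤ LinearMap.ker μ) ∧ T ∘ₗ boundary R = μ ∘ₗ pairing R A E.e := by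
  rw [exactnessRelations, sup_le_iff, Submodule.prod_le_iff, Submodule.map_le_iff_le_comap,
    Submodule.map_le_iff_le_comap, ← LinearMap.ker_comp, ← LinearMap.ker_comp,
    LinearMap.coprod_inl, LinearMap.coprod_inr, sup_le_iff, LinearMap.range_le_ker_iff,
    LinearMap.coprod_comp_prod, LinearMap.comp_neg, ← sub_eq_add_neg, sub_eq_zero]

theorem isExactnessKernel_comap_exactnessRelations (hR : R.IsFiniteType) :
    E.IsExactnessKernel i ((E.exactnessRelations i).comap (LinearMap.inr k _ A)) := by
  intro Y _ _ μ
  rw [← exists_le_ker_coprod_iff]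
  simp only [exactnessRelations_le_ker_coprod_iff]
  constructor
  · rintro ⟨T, ⟨⟨hdeg, hleibniz⟩, hker⟩, hT⟩
    obtain ⟨θ, hθ, rfl⟩ := exists_pairing_eq hR hdeg
    refine ⟨⟨θ, ⟨leibnizRelations_le_ker_pairing_iff.1 hleibniz, hθ⟩, pairing_injective ?_⟩, hker⟩
    rw [pairing_coboundary, hT, pairing_kodairaSpencer]
  · rintro ⟨⟨θ, ⟨hθ, hdeg⟩, hθμ⟩, hker⟩
    refine ⟨pairing R Y θ, ⟨⟨degreeRelations_le_ker_pairing hdeg,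
      leibnizRelations_le_ker_pairing_iff.2 hθ⟩, hker⟩, ?_⟩
    rw [← pairing_coboundary, hθμ, pairing_kodairaSpencer]

theorem exists_isExactnessKernel (h : R.IsFiniteType ∨ A.IsFiniteType) :
    ∃ N, E.IsExactnessKernel i N := by
  rcases h with hR | hA
  · exact ⟨_, E.isExactnessKernel_comap_exactnessRelations i hR⟩
  · have := hA i
    exact ⟨_, E.isExactnessKernel_dualCoannihilator i⟩

end Deformation

/-! ### Products with trivial families -/

namespace WHom

theorem apply_eq_of_toFirstOrder_eq (hZ : Z.IsSquareZero) (f : WHom A Z) {a b : A}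
    (h : A.toFirstOrder a = A.toFirstOrder b) : f a = f b := by
  rw [← sub_eq_zero, ← map_sub]
  exact f.eq_zero_of_mem_maxIdeal_sq hZ (toFirstOrder_eq_iff.1 h)

/-- The cotangent subspace spanned by the image of a morphism. -/
def cotangentRange (g : WHom B A) : Submodule k A :=
  LinearMap.range g.toAlgHom.toLinearMap ⊔ (A.maxIdeal ^ 2).restrictScalars k

theorem apply_mem_cotangentRange (g : WHom B A) (b : B) : g b ∈ g.cotangentRange :=
  Submodule.mem_sup_left ⟨b, rfl⟩

theorem isCotangentSubspace_cotangentRange (g : WHom B A) :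
    IsCotangentSubspace g.cotangentRange where
  isHomogeneous n a ha := by
    change A.proj n a ∈ g.cotangentRange
    obtain ⟨_, ⟨b, rfl⟩, m, hm, rfl⟩ := Submodule.mem_sup.1 ha
    rw [map_add]
    refine add_mem ?_ (Submodule.mem_sup_right (maxIdeal_sq_isHomogeneous n hm))
    rw [AlgHom.toLinearMap_apply, ← g.map_proj]
    exact g.apply_mem_cotangentRange _
  one_mem := by simpa only [map_one] using g.apply_mem_cotangentRange 1
  mem_of_mem_sq _ ha := Submodule.mem_sup_right ha

theorem toFirstOrder_apply_apply_of_mem_cotangentRange {f : WHom A B} {g : WHom B A}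
    (hfg : ∀ b, B.toFirstOrder (f (g b)) = B.toFirstOrder b) {a : A}
    (ha : a ∈ g.cotangentRange) : A.toFirstOrder (g (f a)) = A.toFirstOrder a := by
  obtain ⟨_, ⟨b, rfl⟩, m, hm, rfl⟩ := Submodule.mem_sup.1 ha
  have hm₀ : A.toFirstOrder m = A.toFirstOrder 0 := by
    rwa [map_zero, toFirstOrder_eq_zero_iff]
  have hgfm : A.toFirstOrder (g (f m)) = A.toFirstOrder (g (f 0)) :=
    (g.comp f).toFirstOrder_congr hm₀
  have hgfg : A.toFirstOrder (g (f (g b))) = A.toFirstOrder (g b) := g.toFirstOrder_congr (hfg b)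
  simp only [map_add, AlgHom.toLinearMap_apply, hgfg, hgfm, hm₀, map_zero]

end WHom

namespace CoordinateSystem

section

variable {f : WHom A B} {g : WHom B A} (S : CoordinateSystem g.cotangentRange)

/-- The morphism `B ⊗ k[x] → A` that is `g` on `B` and maps the coordinates to their lifts,
corrected by elements of the image of `g`. -/
def productMap (f : WHom A B) : WHom (tensor B S.poly) A :=
  g.tensorLift (polyLift (fun s => S.lift s - g (f (S.lift s))) fun s =>
    sub_mem (S.lift_mem_part s) (g.map_mem _ _ (f.map_mem _ _ (S.lift_mem_part s))))

variable {φ : WHom A (tensor B S.poly)}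

theorem toFirstOrder_apply_productMap
    (hfg : ∀ b, B.toFirstOrder (f (g b)) = B.toFirstOrder b)
    (hφ : (tensor B S.poly).toFirstOrder.comp φ =
      S.firstOrderGraph g.isCotangentSubspace_cotangentRange f) (x : tensor B S.poly) :
    (tensor B S.poly).toFirstOrder (φ (S.productMap f x)) = (tensor B S.poly).toFirstOrder x := by
  let inl : WHom B (tensor B S.poly) := tensorInl B S.poly
  let inr : WHom S.poly (tensor B S.poly) := tensorInr B S.poly
  have hφa : ∀ a, (tensor B S.poly).toFirstOrder (φ a) =
      (tensor B S.poly).toFirstOrder (inl (f a) + inr (S.linearForm a)) := fun a =>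
    (WHom.congr_apply hφ a).trans (S.firstOrderGraph_apply _ f a)
  have hφg : ∀ b, (tensor B S.poly).toFirstOrder (φ (g b)) =
      (tensor B S.poly).toFirstOrder (inl b) := fun b => by
    rw [hφa, S.linearForm_eq_zero (g.apply_mem_cotangentRange b), map_zero, add_zero]
    exact inl.toFirstOrder_congr (hfg b)
  suffices h : ((tensor B S.poly).toFirstOrder.comp (φ.comp (S.productMap f))) =
      (tensor B S.poly).toFirstOrder from WHom.congr_apply h x
  refine WHom.tensor_ext (fun b => ?_) fun p => ?_
  · simp only [WHom.comp_apply, productMap, WHom.tensorLift_inl]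
    exact hφg b
  · suffices h : (((tensor B S.poly).toFirstOrder.comp (φ.comp (S.productMap f))).comp inr) =
        (tensor B S.poly).toFirstOrder.comp inr from WHom.congr_apply h p
    refine WHom.poly_ext fun s => ?_
    simp only [WHom.comp_apply, productMap, inr, WHom.tensorLift_inr, polyLift_polyVar, map_sub,
      hφg]
    rw [hφa, S.linearForm_lift, map_add, add_sub_cancel_left]

theorem toFirstOrder_productMap_apply
    (hfg : ∀ b, B.toFirstOrder (f (g b)) = B.toFirstOrder b)
    (hφ : (tensor B S.poly).toFirstOrder.comp φ =
      S.firstOrderGraph g.isCotangentSubspace_cotangentRange f) (a : A) :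
    A.toFirstOrder (S.productMap f (φ a)) = A.toFirstOrder a := by
  have hφa : A.toFirstOrder (S.productMap f (φ a)) = A.toFirstOrder
      (S.productMap f (tensorInl B S.poly (f a) + tensorInr B S.poly (S.linearForm a))) :=
    (S.productMap f).toFirstOrder_congr
      ((WHom.congr_apply hφ a).trans (S.firstOrderGraph_apply _ f a))
  have hlinear := S.apply_linearForm
    (S.productMap f |>.comp (tensorInr B S.poly)).toAlgHom.toLinearMap
    (LinearMap.id - (g.comp f).toAlgHom.toLinearMap)
    (fun s => by
      simp only [AlgHom.toLinearMap_apply, WHom.comp_apply, productMap, WHom.tensorLift_inr,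
        polyLift_polyVar, LinearMap.sub_apply, LinearMap.id_apply]) a
  have hgf := WHom.toFirstOrder_apply_apply_of_mem_cotangentRange hfg
    (S.sub_combination_coord_mem a)
  simp only [AlgHom.toLinearMap_apply, WHom.comp_apply, LinearMap.sub_apply,
    LinearMap.id_apply] at hlinear
  rw [hφa, map_add, hlinear, productMap, WHom.tensorLift_inl]
  simp only [map_add, map_sub] at hgf ⊢
  linear_combination hgf

theorem bijective_of_toFirstOrder_comp_eq
    (hfg : ∀ b, B.toFirstOrder (f (g b)) = B.toFirstOrder b)
    (hφ : (tensor B S.poly).toFirstOrder.comp φ =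
      S.firstOrderGraph g.isCotangentSubspace_cotangentRange f) : Function.Bijective φ :=
  WHom.bijective_of_toFirstOrder_inverse (S.toFirstOrder_productMap_apply hfg hφ)
    (S.toFirstOrder_apply_productMap hfg hφ)

end

end CoordinateSystem

namespace Deformation

theorem IsMiniversal.toFirstOrder_apply_eq {E : Deformation R A} (hE : E.IsMiniversal)
    {f : WHom A A} (h : IsIso (E.map f) E) (a : A) :
    A.toFirstOrder (f a) = A.toFirstOrder a := by
  refine toFirstOrder_apply_eq_of_forall_dual (g := WHom.id A)
    (fun i hi t => (hE.2 i hi).injective ?_) a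
  rw [classify_eq_iff, ← map_map, ← map_map, map_id]
  exact h.map t

theorem IsMiniversal.familyIso {E : Deformation R A} {F : Deformation R B}
    (hE : E.IsMiniversal) (hF : F.IsMiniversal) : E.FamilyIso F := by
  obtain ⟨f, hf⟩ := hE.1.exists_isIso F
  obtain ⟨g, hg⟩ := hF.1.exists_isIso E
  refine ⟨f, WHom.bijective_of_toFirstOrder_inverse (g := g) ?_ ?_, hf⟩
  · refine hE.toFirstOrder_apply_eq (f := g.comp f) ?_
    rw [← map_map]
    exact (hf.map g).trans hg
  · refine hF.toFirstOrder_apply_eq (f := f.comp g) ?_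
    rw [← map_map]
    exact (hg.map f).trans hf

theorem IsVersal.exists_familyIso_prodTrivial {E : Deformation R A} (hE : E.IsVersal)
    {F : Deformation R B} (hF : F.IsMiniversal) :
    ∃ (σ : Type u) (c : σ → ℕ) (hc : ∀ s, 0 < c s), E.FamilyIso (F.prodTrivial (poly k c hc)) := by
  obtain ⟨f, hf⟩ := hE.exists_isIso F
  obtain ⟨g, hg⟩ := hF.1.exists_isIso E
  have hfg : ∀ b, B.toFirstOrder (f (g b)) = B.toFirstOrder b :=
    hF.toFirstOrder_apply_eq (f := f.comp g) (by rw [← map_map]; exact (hg.map f).trans hf)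
  have hT := g.isCotangentSubspace_cotangentRange
  obtain ⟨S⟩ := exists_coordinateSystem hT.one_mem
  let P := tensor B S.poly
  have hgraph : (S.firstOrderGraph hT f).comp g = P.toFirstOrder.comp (tensorInl B S.poly) :=
    WHom.ext fun b => by
      rw [WHom.comp_apply, S.firstOrderGraph_apply,
        S.linearForm_eq_zero (g.apply_mem_cotangentRange b), map_zero, add_zero]
      exact (tensorInl B S.poly).toFirstOrder_congr (hfg b)
  have hiso : IsIso (E.map (S.firstOrderGraph hT f))
      ((F.prodTrivial S.poly).map P.toFirstOrder) := by
    rw [prodTrivial, map_map, ← hgraph, ← map_map]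
    exact (hg.map _).symm
  obtain ⟨φ, hφ, hφF⟩ := hE.exists_lift P.toFirstOrder toFirstOrder_surjective
    firstOrder_isSquareZero _ _ hiso
  exact ⟨S.index, S.weight, S.weight_pos, φ, S.bijective_of_toFirstOrder_comp_eq hfg hφ, hφF⟩

end Deformation

/-! ### The kernel of the Kodaira-Spencer map -/

namespace Deformation

/-- A cotangent subspace that detects the Kodaira-Spencer map: first order families obtained by
base change from `E` are isomorphic precisely when the base changes agree on `T`. -/
structure IsKodairaSpencerKernel (E : Deformation R A) (T : Submodule k A) : Prop
    extends IsCotangentSubspace T where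
  isIso_map_iff : ∀ (Z : WeightedAlgebra k), Z.IsSquareZero → ∀ f g : WHom A Z,
    IsIso (E.map f) (E.map g) ↔ ∀ a ∈ T, f a = g a

namespace IsExactnessKernel

variable {E : Deformation R A} {i : ℕ} {N : Submodule k A}

theorem cotangentKer_le (hN : E.IsExactnessKernel i N) : A.cotangentKer i ≤ N :=
  ((hN _ N.mkQ).1 N.ker_mkQ.ge).2.trans N.ker_mkQ.le

theorem mem_of_proj_eq_zero (hN : E.IsExactnessKernel i N) {a : A} (ha : A.proj i a = 0) :
    a ∈ N :=
  hN.cotangentKer_le (Submodule.mem_sup_left ha)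

theorem proj_mem (hN : E.IsExactnessKernel i N) (n : ℕ) {a : A} (ha : a ∈ N) :
    A.proj n a ∈ N := by
  rcases eq_or_ne n i with rfl | hn
  · have h : a - A.proj n a ∈ N := hN.mem_of_proj_eq_zero (by
      rw [map_sub, proj_of_mem (WeightedAlgebra.proj_mem n a), sub_self])
    simpa only [sub_sub_cancel] using sub_mem ha h
  · exact hN.mem_of_proj_eq_zero (proj_of_mem_of_ne (WeightedAlgebra.proj_mem n a) hn)

end IsExactnessKernel

variable {E : Deformation R A} {N : ℕ → Submodule k A}

theorem isCotangentSubspace_iInf (hN : ∀ i, E.IsExactnessKernel i (N i)) :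
    IsCotangentSubspace (⨅ i, ⨅ _ : 0 < i, N i) where
  isHomogeneous n a ha := by
    simp only [Submodule.mem_iInf] at ha ⊢
    exact fun i hi => (hN i).proj_mem n (ha i hi)
  one_mem := by
    simp only [Submodule.mem_iInf]
    exact fun i hi => (hN i).mem_of_proj_eq_zero (proj_one_of_pos hi)
  mem_of_mem_sq a ha := by
    simp only [Submodule.mem_iInf]
    exact fun i _ => (hN i).cotangentKer_le (Submodule.mem_sup_right ha)

theorem proj_mem_iInf (hN : ∀ i, E.IsExactnessKernel i (N i)) {i : ℕ} {a : A} (ha : a ∈ N i) :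
    A.proj i a ∈ ⨅ j, ⨅ _ : 0 < j, N j := by
  simp only [Submodule.mem_iInf]
  intro j _
  rcases eq_or_ne i j with rfl | hij
  · exact (hN i).proj_mem i ha
  · exact (hN j).mem_of_proj_eq_zero (proj_of_mem_of_ne (WeightedAlgebra.proj_mem i a) hij)

theorem cotangentKer_le_ker_toPart_sub (hZ : Z.IsSquareZero) (f g : WHom A Z) (i : ℕ) :
    A.cotangentKer i ≤
      LinearMap.ker (Z.toPart i ∘ₗ (f.toAlgHom.toLinearMap - g.toAlgHom.toLinearMap)) := by
  refine sup_le (fun a ha => Subtype.ext ?_) fun a ha => ?_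
  · change Z.proj i (f a - g a) = 0
    rw [map_sub, ← f.map_proj, ← g.map_proj, LinearMap.mem_ker.1 ha, map_zero, map_zero, sub_self]
  · have hfg : f a - g a = 0 := by
      rw [f.eq_zero_of_mem_maxIdeal_sq hZ ha, g.eq_zero_of_mem_maxIdeal_sq hZ ha, sub_self]
    exact (congrArg (Z.toPart i) hfg).trans (map_zero _)

theorem isIso_map_iff_forall_le_ker (hN : ∀ i, E.IsExactnessKernel i (N i)) (hZ : Z.IsSquareZero)
    {f g : WHom A Z} : IsIso (E.map f) (E.map g) ↔ ∀ i, 0 < i →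
      N i ≤ LinearMap.ker (Z.toPart i ∘ₗ (f.toAlgHom.toLinearMap - g.toAlgHom.toLinearMap)) := by
  simp only [isIso_map_iff hZ, hN _ _ _, cotangentKer_le_ker_toPart_sub hZ f g, and_true]

theorem isKodairaSpencerKernel_iInf (hN : ∀ i, E.IsExactnessKernel i (N i)) :
    E.IsKodairaSpencerKernel (⨅ i, ⨅ _ : 0 < i, N i) where
  toIsCotangentSubspace := isCotangentSubspace_iInf hN
  isIso_map_iff Z hZ f g := by
    rw [isIso_map_iff_forall_le_ker hN hZ]
    constructor
    · intro h a ha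
      refine eq_of_forall_proj_eq fun i => ?_
      rcases i.eq_zero_or_pos with rfl | hi
      · obtain ⟨c, hc⟩ := exists_algebraMap_eq_of_mem_part_zero (WeightedAlgebra.proj_mem 0 a)
        rw [← f.map_proj, ← g.map_proj, ← hc, AlgHom.commutes, AlgHom.commutes]
      · simp only [Submodule.mem_iInf] at ha
        have hproj : Z.proj i (f a - g a) = 0 := congrArg Subtype.val (h i hi (ha i hi))
        rwa [map_sub, sub_eq_zero] at hproj
    · intro h i _ a ha
      have hi := h _ (proj_mem_iInf hN ha)
      refine Subtype.ext ?_
      change Z.proj i (f a - g a) = 0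
      rw [map_sub, ← f.map_proj, ← g.map_proj, hi, sub_self]

theorem exists_isKodairaSpencerKernel (E : Deformation R A)
    (h : R.IsFiniteType ∨ A.IsFiniteType) : ∃ T, E.IsKodairaSpencerKernel T := by
  choose N hN using fun i => E.exists_isExactnessKernel i h
  exact ⟨_, isKodairaSpencerKernel_iInf hN⟩

end Deformation

/-! ### Miniversal families -/

namespace CoordinateSystem

variable {T : Submodule k A} (S : CoordinateSystem T)

/-- The retraction `A ⊗ k[x] → A` that maps the coordinates to the negatives of their lifts. -/
def evalNegLift : WHom (tensor A S.poly) A :=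
  (WHom.id A).tensorLift (polyLift (fun s => -S.lift s) fun s => neg_mem (S.lift_mem_part s))

theorem evalNegLift_inl (a : A) : S.evalNegLift (tensorInl A S.poly a) = a :=
  WHom.tensorLift_inl _ _ a

theorem evalNegLift_inr_polyVar (s : S.index) :
    S.evalNegLift (tensorInr A S.poly (polyVar S.weight_pos s)) = -S.lift s :=
  (WHom.tensorLift_inr _ _ _).trans (polyLift_polyVar _ _ s)

theorem evalNegLift_inr_linearForm (a : A) :
    S.evalNegLift (tensorInr A S.poly (S.linearForm a)) = -S.combination (S.coord a) :=
  S.apply_linearForm (S.evalNegLift.comp (tensorInr A S.poly)).toAlgHom.toLinearMap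
    (-LinearMap.id) S.evalNegLift_inr_polyVar a

variable (φ : WHom A (tensor A S.poly))

/-- The `A`-algebra endomorphism of `A ⊗ k[x]` that maps the coordinates to the increments of `φ`
on their lifts. -/
def increment : WHom (tensor A S.poly) (tensor A S.poly) :=
  (tensorInl A S.poly).tensorLift
    (polyLift (fun s => φ (S.lift s) - tensorInl A S.poly (S.lift s)) fun s =>
      sub_mem (φ.map_mem _ _ (S.lift_mem_part s))
        ((tensorInl A S.poly).map_mem _ _ (S.lift_mem_part s)))

theorem increment_inl (a : A) :
    S.increment φ (tensorInl A S.poly a) = tensorInl A S.poly a :=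
  WHom.tensorLift_inl _ _ a

theorem increment_inr_polyVar (s : S.index) :
    S.increment φ (tensorInr A S.poly (polyVar S.weight_pos s)) =
      φ (S.lift s) - tensorInl A S.poly (S.lift s) :=
  (WHom.tensorLift_inr _ _ _).trans (polyLift_polyVar _ _ s)

variable {φ} {hT : IsCotangentSubspace T}

theorem toFirstOrder_apply_eq
    (hφ : (tensor A S.poly).toFirstOrder.comp φ = S.firstOrderGraph hT (WHom.id A)) (a : A) :
    (tensor A S.poly).toFirstOrder (φ a) = (tensor A S.poly).toFirstOrder
      (tensorInl A S.poly a + tensorInr A S.poly (S.linearForm a)) :=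
  (WHom.congr_apply hφ a).trans (S.firstOrderGraph_apply hT _ a)

theorem toFirstOrder_increment
    (hφ : (tensor A S.poly).toFirstOrder.comp φ = S.firstOrderGraph hT (WHom.id A))
    (x : tensor A S.poly) :
    (tensor A S.poly).toFirstOrder (S.increment φ x) = (tensor A S.poly).toFirstOrder x := by
  suffices h : (tensor A S.poly).toFirstOrder.comp (S.increment φ) =
      (tensor A S.poly).toFirstOrder from WHom.congr_apply h x
  refine WHom.tensor_ext (fun a => ?_) fun p => ?_
  · rw [WHom.comp_apply, increment_inl]
  · suffices h : ((tensor A S.poly).toFirstOrder.comp (S.increment φ)).comp (tensorInr A S.poly) =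
        (tensor A S.poly).toFirstOrder.comp (tensorInr A S.poly) from WHom.congr_apply h p
    refine WHom.poly_ext fun s => ?_
    simp only [WHom.comp_apply, increment_inr_polyVar, map_sub]
    rw [S.toFirstOrder_apply_eq hφ, S.linearForm_lift, map_add, add_sub_cancel_left]

theorem exists_retraction
    (hφ : (tensor A S.poly).toFirstOrder.comp φ = S.firstOrderGraph hT (WHom.id A)) :
    ∃ ρ : WHom (tensor A S.poly) A, ρ.comp (tensorInl A S.poly) = WHom.id A ∧
      (∀ s, ρ (φ (S.lift s)) = 0) ∧
      ∀ a, A.toFirstOrder (ρ (φ a)) = A.toFirstOrder (a - S.combination (S.coord a)) := by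
  have hbij : Function.Bijective (S.increment φ) :=
    WHom.bijective_of_toFirstOrder_apply_eq (S.toFirstOrder_increment hφ)
  let ρ := S.evalNegLift.comp ((S.increment φ).inverse hbij)
  have hρ : ∀ x, ρ (S.increment φ x) = S.evalNegLift x := fun x => by
    rw [WHom.comp_apply, WHom.inverse_apply_apply]
  have hinl : ∀ a, ρ (tensorInl A S.poly a) = a := fun a => by
    rw [← S.increment_inl φ, hρ, evalNegLift_inl]
  have hfirst : ∀ x, A.toFirstOrder (ρ x) = A.toFirstOrder (S.evalNegLift x) := fun x => by
    rw [← hρ]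
    exact ρ.toFirstOrder_congr (S.toFirstOrder_increment hφ x).symm
  refine ⟨ρ, WHom.ext hinl, fun s => ?_, fun a => ?_⟩
  · have h := hρ (tensorInr A S.poly (polyVar S.weight_pos s))
    rwa [increment_inr_polyVar, evalNegLift_inr_polyVar, map_sub, hinl, sub_eq_neg_self] at h
  · rw [hfirst, S.evalNegLift.toFirstOrder_congr (S.toFirstOrder_apply_eq hφ a), map_add,
      evalNegLift_inl, evalNegLift_inr_linearForm, sub_eq_add_neg]

end CoordinateSystem

namespace Deformation

variable {E : Deformation R A}

theorem IsVersal.exists_projection (hE : E.IsVersal) {T : Submodule k A}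
    (hT : E.IsKodairaSpencerKernel T) (S : CoordinateSystem T) :
    ∃ r : WHom A A, IsIso (E.map r) E ∧ (∀ s, r (S.lift s) = 0) ∧
      ∀ a, A.toFirstOrder (r a) = A.toFirstOrder (a - S.combination (S.coord a)) := by
  let P := tensor A S.poly
  let graph := S.firstOrderGraph hT.toIsCotangentSubspace (WHom.id A)
  have hgraph : ∀ a ∈ T, graph a = (P.toFirstOrder.comp (tensorInl A S.poly)) a := fun a ha => by
    rw [S.firstOrderGraph_apply, S.linearForm_eq_zero ha, map_zero, add_zero]
    rfl
  obtain ⟨φ, hφ, hφE⟩ := hE.exists_lift P.toFirstOrder toFirstOrder_surjective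
    firstOrder_isSquareZero graph (E.map (tensorInl A S.poly)) (by
      rw [map_map]
      exact (hT.isIso_map_iff _ firstOrder_isSquareZero _ _).2 hgraph)
  obtain ⟨ρ, hinl, hlift, hfirst⟩ := S.exists_retraction hφ
  refine ⟨ρ.comp φ, ?_, hlift, hfirst⟩
  have h := hφE.map ρ
  rwa [map_map, map_map, hinl, map_id] at h

theorem IsVersal.map_of_section (hE : E.IsVersal) {π : WHom A B} {g : WHom B A}
    (hg : IsIso ((E.map π).map g) E) (hπg : ∀ b, B.toFirstOrder (π (g b)) = B.toFirstOrder b) :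
    (E.map π).IsVersal := by
  refine isVersal_of_exists_lift fun C C' p hp hC' f' G hG => ?_
  have hlift : IsIso (E.map (f'.comp π)) (G.map p) := by rwa [← map_map]
  obtain ⟨f, hf, hfG⟩ := hE.exists_lift p hp hC' (f'.comp π) G hlift
  refine ⟨f.comp g, WHom.ext fun b => ?_, ?_⟩
  · exact (WHom.congr_apply hf (g b)).trans (WHom.apply_eq_of_toFirstOrder_eq hC' f' (hπg b))
  · rw [← map_map]
    exact (hg.map f).trans hfG

end Deformation

/-- The ideal generated by the lifts of the coordinates. -/
def CoordinateSystem.ideal {T : Submodule k A} (S : CoordinateSystem T) : Ideal A :=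
  Ideal.span (Set.range S.lift)

namespace CoordinateSystem

variable {T : Submodule k A} (S : CoordinateSystem T)

theorem ideal_isHomogeneous : S.ideal.IsHomogeneous A.part :=
  Ideal.homogeneous_span A.part _ (by
    rintro _ ⟨s, rfl⟩
    exact ⟨_, S.lift_mem_part s⟩)

theorem ideal_le_maxIdeal : S.ideal ≤ A.maxIdeal := by
  refine Ideal.span_le.2 ?_
  rintro _ ⟨s, rfl⟩
  exact mem_maxIdeal_of_mem_part (S.weight_pos s) (S.lift_mem_part s)

theorem combination_mem_ideal (x : S.index →₀ k) : S.combination x ∈ S.ideal :=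
  Submodule.sum_mem _ fun s _ => Submodule.smul_of_tower_mem _ _
    (Ideal.subset_span (Set.mem_range_self s))

/-- The quotient of `A` by the ideal generated by the lifts of the coordinates. -/
abbrev quot : WeightedAlgebra k := A.quot S.ideal S.ideal_isHomogeneous S.ideal_le_maxIdeal

/-- The projection `A → S.quot`. -/
def mkQuot : WHom A S.quot := WeightedAlgebra.mkQuot _ _ _

theorem mkQuot_sub_combination (a : A) : S.mkQuot (a - S.combination (S.coord a)) = S.mkQuot a :=
  mkQuot_eq_iff.2 (by simpa using S.combination_mem_ideal (S.coord a))

theorem quot_hom_ext {f g : WHom S.quot Z}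
    (h : ∀ a ∈ T, f (S.mkQuot a) = g (S.mkQuot a)) : f = g := by
  refine WHom.ext fun x => ?_
  obtain ⟨a, rfl⟩ : ∃ a, S.mkQuot a = x := mkQuot_surjective x
  rw [← S.mkQuot_sub_combination]
  exact h _ (S.sub_combination_coord_mem a)

end CoordinateSystem

namespace Deformation

variable {E : Deformation R A}

theorem IsVersal.isMiniversal_map_mkQuot (hE : E.IsVersal) {T : Submodule k A}
    (hT : E.IsKodairaSpencerKernel T) (S : CoordinateSystem T) :
    (E.map S.mkQuot).IsMiniversal := by
  obtain ⟨r, hr, hlift, hfirst⟩ := hE.exists_projection hT S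
  have hideal : S.ideal ≤ RingHom.ker r.toAlgHom := Ideal.span_le.2 (by
    rintro _ ⟨s, rfl⟩
    exact hlift s)
  let g : WHom S.quot A := liftQuot r fun a ha => hideal ha
  have hversal : (E.map S.mkQuot).IsVersal := by
    refine hE.map_of_section (g := g) (by rwa [map_map]) fun x => ?_
    obtain ⟨a, rfl⟩ : ∃ a, S.mkQuot a = x := mkQuot_surjective x
    exact (S.mkQuot.toFirstOrder_congr (hfirst a)).trans
      (congrArg S.quot.toFirstOrder (S.mkQuot_sub_combination a))
  refine ⟨hversal, fun i hi => ⟨fun f f' hff' => ?_, fun m => ?_⟩⟩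
  · rw [classify_eq_iff, map_map, map_map, hT.isIso_map_iff _ dual_isSquareZero] at hff'
    exact S.quot_hom_ext hff'
  · induction m using Quotient.inductionOn with
    | _ G =>
      obtain ⟨f, hf⟩ := hversal.exists_isIso G
      exact ⟨f, Quotient.sound hf⟩

end Deformation

end

end WeightedDeformation

theorem mainTheorem6_general {k : Type u} [Field k]
    (R : WeightedDeformation.WeightedDGCA.{u, v} k) :
    (∀ (A : WeightedDeformation.WeightedAlgebra k) (E : WeightedDeformation.Deformation R A),
      E.IsVersal →
        (R.IsFiniteType ∨ A.IsFiniteType →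
          ∃ (B : WeightedDeformation.WeightedAlgebra k) (F : WeightedDeformation.Deformation R B),
            F.IsMiniversal ∧
            ∃ (σ : Type u) (c : σ → ℕ) (hc : ∀ s, 0 < c s),
              E.FamilyIso (F.prodTrivial (WeightedDeformation.poly k c hc))) ∧
        (∀ (B : WeightedDeformation.WeightedAlgebra k) (F : WeightedDeformation.Deformation R B),
          F.IsMiniversal →
            ∃ (σ : Type u) (c : σ → ℕ) (hc : ∀ s, 0 < c s),
              E.FamilyIso (F.prodTrivial (WeightedDeformation.poly k c hc)))) ∧
    (∀ (B B' : WeightedDeformation.WeightedAlgebra k)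
      (F : WeightedDeformation.Deformation R B) (F' : WeightedDeformation.Deformation R B'),
      F.IsMiniversal → F'.IsMiniversal → F.FamilyIso F') := by
  refine ⟨fun A E hE => ⟨fun hfin => ?_, fun B F hF => hE.exists_familyIso_prodTrivial hF⟩,
    fun B B' F F' hF hF' => hF.familyIso hF'⟩
  obtain ⟨T, hT⟩ := E.exists_isKodairaSpencerKernel hfin
  obtain ⟨S⟩ := WeightedDeformation.exists_coordinateSystem hT.one_mem
  have hF := hE.isMiniversal_map_mkQuot hT S
  exact ⟨S.quot, E.map S.mkQuot, hF, hE.exists_familyIso_prodTrivial hF⟩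

theorem mainTheorem6 {k : Type u} [Field k] [CharZero k]
    (H : WeightedDeformation.SimplyConnectedCGA.{u, w} k)
    (R : WeightedDeformation.WeightedDGCA.{u, v} k)
    (M : WeightedDeformation.WeightedModel R H) :
    (∀ (A : WeightedDeformation.WeightedAlgebra k) (E : WeightedDeformation.Deformation R A),
      E.IsVersal →
        (R.IsFiniteType ∨ A.IsFiniteType →
          ∃ (B : WeightedDeformation.WeightedAlgebra k) (F : WeightedDeformation.Deformation R B),
            F.IsMiniversal ∧
            ∃ (σ : Type u) (c : σ → ℕ) (hc : ∀ s, 0 < c s),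
              E.FamilyIso (F.prodTrivial (WeightedDeformation.poly k c hc))) ∧
        (∀ (B : WeightedDeformation.WeightedAlgebra k) (F : WeightedDeformation.Deformation R B),
          F.IsMiniversal →
            ∃ (σ : Type u) (c : σ → ℕ) (hc : ∀ s, 0 < c s),
              E.FamilyIso (F.prodTrivial (WeightedDeformation.poly k c hc)))) ∧
    (∀ (B B' : WeightedDeformation.WeightedAlgebra k)
      (F : WeightedDeformation.Deformation R B) (F' : WeightedDeformation.Deformation R B'),
      F.IsMiniversal → F'.IsMiniversal → F.FamilyIso F') :=
  mainTheorem6_general R
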